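/- Let $K$ be an algebraically closed field, complete with respect to a nontrivial non-Archimedean absolute value $|\cdot|$, fix a base $q>1$ and write $\log_v=\log_q$. Let $\mathbf P^1_K$ be the Berkovich projective line over $K$, $\mathbf H^1_K$ the complement of its type I points, and $\zeta_{\rm G}$ the Gauss point. For $x\in\mathbf P^1_K$ let $\mathrm{diam}_{\zeta_{\rm G}}(x)$ be the radius of the disc corresponding to $x$ if $x$ lies in the closed unit disc (the limit of the radii for type IV points), and $\mathrm{diam}_{\zeta_{\rm G}}(1/x)$ otherwise. Let $x\wedge y$ be the point where the paths $[x,\zeta_{\rm G}]$ and $[y,\zeta_{\rm G}]$ meet, and put on $\mathbf H^1_K$ the metric $$\rho(x,y)=2\log_v \mathrm{diam}_{\zeta_{\rm G}}(x\wedge y)-\log_v\mathrm{diam}_{\zeta_{\rm G}}(x)-\log_v\mathrm{diam}_{\zeta_{\rm G}}(y),$$ with closed balls $B_\rho(x,R)=\{y\in\mathbf H^1_K:\rho(x,y)\le R\}$. For $\phi\in K(z)$ of degree $d\ge 1$ let $\mathrm{ordRes}(\phi)=-\log_v|\mathrm{Res}(F,G)|$, where $F,G$ are binary forms of degree $d$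 over the valuation ring of $K$, at least one coefficient of which is a unit, with $\phi(z)=F(z,1)/G(z,1)$. Let $\mathrm{ordRes}_\phi:\mathbf P^1_K\to[0,\infty]$ be the extension, continuous for the strong topology (given by the metric $2\,\mathrm{diam}_{\zeta_{\rm G}}(x\wedge y)-\mathrm{diam}_{\zeta_{\rm G}}(x)-\mathrm{diam}_{\zeta_{\rm G}}(y)$), of the function on type II points $\mathrm{ordRes}_\phi(\gamma(\zeta_{\rm G}))=\mathrm{ordRes}(\gamma^{-1}\circ\phi\circ\gamma)$, $\gamma\in\mathrm{PGL}_2(K)$. Let $\mathrm{MinResLoc}(\phi)$ be the set of points of $\mathbf P^1_K$ at which $\mathrm{ordRes}_\phi$ attains its minimum. **Corollary.** Let $\phi\in K(z)$ have degree $d\ge2$ and let $R=\frac{2}{d-1}\,\mathrm{ordRes}(\phi)$. Then for every $n\ge1$ $$\mathrm{MinResLoc}(\phi^n)\subseteq B_\rho(\zeta_{\rm G},R),$$ where $\phi^n$ is the $n$-th iterate. In particular the $\rho$-diameter satisfies $\mathrm{diam}\,\mathrm{MinResLoc}(\phi^n)\le\frac{4}{d-1}\,\mathrm{ordRes}(\phi)$.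 -/

import Mathlib

open Polynomial Filter Topology

noncomputable section

namespace Berk

/-! ### The Berkovich line -/

section Line

variable (K : Type*) [NontriviallyNormedField K]

/-- The Berkovich affine line: multiplicative seminorms on `K[T]` extending the absolute value
of `K`. -/
structure A1 extends MulRingSeminorm K[X] where
  map_C' : ∀ a : K, toFun (C a) = ‖a‖

/-- The Berkovich projective line, the affine line together with one further point `∞`. -/
abbrev P1 := OnePoint (A1 K)

variable {K}

instance : CoeFun (A1 K) (fun _ => K[X] → ℝ) := ⟨fun x => x.toFun⟩

/-- The type I point `ζ_{a,0}`, i.e. `f ↦ |f(a)|`. -/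
def A1.classical (a : K) : A1 K where
  toFun f := ‖f.eval a‖
  map_zero' := by simp
  add_le' f g := by simpa using norm_add_le (f.eval a) (g.eval a)
  neg' f := by simp
  map_one' := by simp
  map_mul' f g := by simp
  map_C' b := by simp

/-- The point `ζ_{a,r}` attached to the disc `D(a,r)`, `r > 0`. The sup norm of `f` on `D(a,r)` is
the Gauss norm `max |c_i| r^i` of the expansion `f = ∑ c_i (T - a)^i`. -/
def A1.disc [IsUltrametricDist K] (a : K) (r : ℝ) (hr : 0 < r) : A1 K where
  toFun f := (taylor a f).gaussNorm (NormedField.toAbsoluteValue K) r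
  map_zero' := by simp
  add_le' f g := by
    rw [map_add]
    have h := isNonarchimedean_gaussNorm (NormedField.toAbsoluteValue K)
      (fun x y => IsUltrametricDist.norm_add_le_max x y) hr.le (taylor a f) (taylor a g)
    have h1 := gaussNorm_nonneg (NormedField.toAbsoluteValue K) (taylor a f) hr.le
    have h2 := gaussNorm_nonneg (NormedField.toAbsoluteValue K) (taylor a g) hr.le
    exact h.trans (max_le (by linarith) (by linarith))
  neg' f := by
    rw [map_neg, ← neg_one_mul, ← C_1, ← C_neg,
      gaussNorm_mul (fun x y => IsUltrametricDist.norm_add_le_max x y) hr, gaussNorm_C]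
    simp
  map_one' := by
    rw [taylor_one, gaussNorm_C]
    simp
  map_mul' f g := by
    rw [taylor_mul]
    exact gaussNorm_mul (fun x y => IsUltrametricDist.norm_add_le_max x y) hr _ _
  map_C' b := by
    rw [taylor_C, gaussNorm_C]
    rfl

/-- The Gauss point `ζ_{0,1}`. -/
def gaussA1 [IsUltrametricDist K] : A1 K := A1.disc 0 1 one_pos

/-- The Gauss point `ζ_G` as a point of the projective line. -/
def gauss [IsUltrametricDist K] : P1 K := (gaussA1 : A1 K)

/-- Type I points: the points `a ∈ K` and `∞`. -/
def typeI : Set (P1 K) := {x | x = OnePoint.infty ∨ ∃ a : K, x = (A1.classical a : A1 K)}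

/-- Type II points: `ζ_{a,r}` with `r = |b|` in the value group. -/
def typeII [IsUltrametricDist K] : Set (P1 K) :=
  {x | ∃ (a b : K) (hb : b ≠ 0), x = (A1.disc a ‖b‖ (norm_pos_iff.mpr hb) : A1 K)}

variable (K) in
/-- Hyperbolic space: everything except the type I points. -/
def H1 : Set (P1 K) := typeIᶜ

/-! ### Paths to the Gauss point, diameters and the two metrics -/

/-- Let `F(X, Y)` be the binary form of degree `n` with `F(T, 1) = f` (`deg f ≤ n`). This is the
value at `F` of the homogeneous seminorm of the point `x`, normalized so that the larger of the
values at `X` and `Y` is `1`. -/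
def val (x : P1 K) (n : ℕ) (f : K[X]) : ℝ :=
  match x with
  | none => ‖f.coeff n‖
  | some x => x f / max 1 (x X) ^ n

/-- The path `[x, ζ_G]`. For the tree rooted at `ζ_G` it consists of the points `z` whose normalized
seminorm is at least that of `x`. -/
def path (x : P1 K) : Set (P1 K) :=
  {z | ∀ (n : ℕ) (f : K[X]), f.natDegree ≤ n → val x n f ≤ val z n f}

/-- `diam_{ζ_G}(x)`. If `|T|_x ≤ 1` it is the radius of the disc of `x` (the limit of the radii for
type IV), which is the infimum of `|T - a|_x` over `a ∈ K`. If `|T|_x > 1` it is the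
same quantity for the image of `x` under `ψ(z) = 1/z`, whose seminorm
has at `T - a` the value `|1/T - a|_x = |1 - a T|_x / |T|_x`. -/
def diamG (x : P1 K) : ℝ :=
  match x with
  | none => 0
  | some x => if x X ≤ 1 then ⨅ a : K, x (X - C a) else ⨅ a : K, x (1 - C a * X) / x X

/-- `diam_{ζ_G}(x ∧ y)`, where `x ∧ y` is the point at which the paths `[x, ζ_G]` and `[y, ζ_G]`
meet: `[x, ζ_G] ∩ [y, ζ_G] = [x ∧ y, ζ_G]`, and the diameter increases towards `ζ_G`, so this
is the least diameter on the intersection. -/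
def diamWedge (x y : P1 K) : ℝ := sInf (diamG '' (path x ∩ path y))

/-- The small metric `d`, which induces the strong topology of the projective line. -/
def smallDist (x y : P1 K) : ℝ := 2 * diamWedge x y - diamG x - diamG y

/-- The big metric `ρ` on hyperbolic space; `q > 1` is the base of the logarithm `log_v`. -/
def rho (q : ℝ) (x y : P1 K) : ℝ :=
  2 * Real.logb q (diamWedge x y) - Real.logb q (diamG x) - Real.logb q (diamG y)

/-- The closed `ρ`-ball in hyperbolic space. -/
def rhoBall (q : ℝ) (x : P1 K) (R : ℝ) : Set (P1 K) := {y | y ∈ H1 K ∧ rho q x y ≤ R}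

/-- The diameter of a subset of hyperbolic space with respect to `ρ`. -/
def rhoDiam (q : ℝ) (S : Set (P1 K)) : EReal := ⨆ x ∈ S, ⨆ y ∈ S, (rho q x y : EReal)

/-- `γ(x) = y` for the Möbius transformation `γ(T) = (aT+b)/(cT+d)` and points `x`, `y` of the
affine line, i.e. `|f|_y = |f ∘ γ|_x` for all `f`; the denominator `(cT+d)^(deg f)` of `f ∘ γ` has
been cleared. -/
def MapsPoint (γ : GL (Fin 2) K) (x y : A1 K) : Prop :=
  x (C (γ 1 0) * X + C (γ 1 1)) ≠ 0 ∧
  ∀ f : K[X], y f * x (C (γ 1 0) * X + C (γ 1 1)) ^ f.natDegree =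
    x (f.sum fun i c => C c * (C (γ 0 0) * X + C (γ 0 1)) ^ i *
      (C (γ 1 0) * X + C (γ 1 1)) ^ (f.natDegree - i))

end Line

/-! ### Rational functions and the resultant -/

section Rat

variable {K : Type*} [NontriviallyNormedField K]

/-- The degree of a rational function. -/
def deg (φ : RatFunc K) : ℕ := max φ.num.natDegree φ.denom.natDegree

/-- The composition `φ ∘ ψ` (for nonconstant `ψ`). -/
def comp (φ ψ : RatFunc K) : RatFunc K := RatFunc.eval RatFunc.C ψ φ

/-- The iterate `φ^n = φ ∘ ⋯ ∘ φ`. -/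
def iter (φ : RatFunc K) (n : ℕ) : RatFunc K := (comp φ)^[n] RatFunc.X

/-- The rational function `(aT+b)/(cT+d)`. -/
def mobius (γ : GL (Fin 2) K) : RatFunc K :=
  (RatFunc.C (γ 0 0) * RatFunc.X + RatFunc.C (γ 0 1)) /
    (RatFunc.C (γ 1 0) * RatFunc.X + RatFunc.C (γ 1 1))

/-- The conjugate `φ^γ = γ⁻¹ ∘ φ ∘ γ`. -/
def conj (φ : RatFunc K) (γ : GL (Fin 2) K) : RatFunc K :=
  comp (mobius γ⁻¹) (comp φ (mobius γ))

/-- `[F, G]` is a normalized lift of `φ`. A binary form of degree `d = deg φ` is represented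
by its dehomogenization `F(T, 1)`, a polynomial of degree at most `d`. -/
structure IsNormalizedLift (φ : RatFunc K) (F G : K[X]) : Prop where
  natDegree_left : F.natDegree ≤ deg φ
  natDegree_right : G.natDegree ≤ deg φ
  right_ne_zero : G ≠ 0
  eq_div : φ = algebraMap K[X] (RatFunc K) F / algebraMap K[X] (RatFunc K) G
  integral_left : ∀ i, ‖F.coeff i‖ ≤ 1
  integral_right : ∀ i, ‖G.coeff i‖ ≤ 1
  unit : ∃ i, ‖F.coeff i‖ = 1 ∨ ‖G.coeff i‖ = 1

theorem exists_isNormalizedLift (φ : RatFunc K) : ∃ F G, IsNormalizedLift φ F G := by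
  obtain ⟨c, hc, hF, hG, hu⟩ : ∃ c : K, c ≠ 0 ∧ (∀ i, ‖φ.num.coeff i‖ ≤ ‖c‖) ∧
      (∀ i, ‖φ.denom.coeff i‖ ≤ ‖c‖) ∧ ∃ i, φ.num.coeff i = c ∨ φ.denom.coeff i = c := by
    have key : ∀ p : K[X], ∃ i, ∀ j, ‖p.coeff j‖ ≤ ‖p.coeff i‖ := by
      intro p
      obtain ⟨i, -, hi⟩ := Finset.exists_max_image (Finset.range (p.natDegree + 1))
        (fun i => ‖p.coeff i‖) ⟨0, by simp⟩
      refine ⟨i, fun j => ?_⟩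
      by_cases hj : j ≤ p.natDegree
      · exact hi j (by simpa [Nat.lt_succ_iff] using hj)
      · simp [coeff_eq_zero_of_natDegree_lt (not_le.mp hj)]
    obtain ⟨i, hi⟩ := key φ.num
    obtain ⟨j, hj⟩ := key φ.denom
    have h1 : (1 : ℝ) ≤ ‖φ.denom.coeff j‖ := by
      have := hj φ.denom.natDegree
      rwa [coeff_natDegree, (RatFunc.monic_denom φ).leadingCoeff, norm_one] at this
    rcases le_total ‖φ.num.coeff i‖ ‖φ.denom.coeff j‖ with h | h
    · exact ⟨φ.denom.coeff j, norm_pos_iff.mp (by linarith), fun k => (hi k).trans h, hj, j,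
        Or.inr rfl⟩
    · exact ⟨φ.num.coeff i, norm_pos_iff.mp (by linarith), hi, fun k => (hj k).trans h, i,
        Or.inl rfl⟩
  have hc' : 0 < ‖c‖ := norm_pos_iff.mpr hc
  refine ⟨C c⁻¹ * φ.num, C c⁻¹ * φ.denom, ?_, ?_, ?_, ?_, ?_, ?_, ?_⟩
  · exact (natDegree_C_mul_le _ _).trans (le_max_left _ _)
  · exact (natDegree_C_mul_le _ _).trans (le_max_right _ _)
  · exact mul_ne_zero (by simpa using hc) φ.denom_ne_zero
  · have h : algebraMap K[X] (RatFunc K) (C c⁻¹) ≠ 0 := by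
      simpa using hc
    rw [map_mul, map_mul, mul_div_mul_left _ _ h, RatFunc.num_div_denom]
  · intro i
    rw [coeff_C_mul, norm_mul, norm_inv, inv_mul_le_iff₀ hc', mul_one]
    exact hF i
  · intro i
    rw [coeff_C_mul, norm_mul, norm_inv, inv_mul_le_iff₀ hc', mul_one]
    exact hG i
  · obtain ⟨i, hi⟩ := hu
    refine ⟨i, hi.imp (fun h => ?_) (fun h => ?_)⟩ <;>
    rw [coeff_C_mul, h, inv_mul_cancel₀ hc, norm_one]

/-- `ordRes(φ) = -log_v |Res(F, G)|` for a normalized lift `[F, G]` of `φ` (which is unique up to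
a common unit factor); the resultant is that of the binary forms, both of degree `deg φ`. -/
def ordRes (q : ℝ) (φ : RatFunc K) : ℝ :=
  - Real.logb q ‖resultant (exists_isNormalizedLift φ).choose
    (exists_isNormalizedLift φ).choose_spec.choose (deg φ) (deg φ)‖

variable [IsUltrametricDist K]

open Classical in
/-- `ordRes_φ(ζ) = ordRes(φ^γ)` at a type II point `ζ`, where `γ` is a Möbius transformation with
`γ(ζ_G) = ζ`. -/
def ordResII (q : ℝ) (φ : RatFunc K) (x : P1 K) : ℝ :=
  if h : ∃ (γ : GL (Fin 2) K) (y : A1 K), x = (y : P1 K) ∧ MapsPoint γ gaussA1 y then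
    ordRes q (conj φ h.choose) else 0

open Classical in
/-- The function `ordRes_φ` on the projective line: the extension of `ordRes_φ` from the type II
points by continuity in the strong topology, with values in `[-∞, ∞]` (it is `∞` at type I points).
The filter describes type II points `y` with `d(x, y) → 0`. -/
def ordResFun (q : ℝ) (φ : RatFunc K) (x : P1 K) : EReal :=
  if x ∈ typeII then (ordResII q φ x : EReal)
  else limUnder (comap (smallDist x) (𝓝 0) ⊓ 𝓟 typeII) (fun y => (ordResII q φ y : EReal))

/-- The minimal resultant locus: the set where `ordRes_φ` attains its minimum. -/
def MinResLoc (q : ℝ) (φ : RatFunc K) : Set (P1 K) :=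
  {x | ∀ y, ordResFun q φ x ≤ ordResFun q φ y}

end Rat

end Berk

end

/-! Write ‖(p, r)‖ for the larger of two Gauss norms, let (F, G) be a normalized lift of φ, and put
N = d^n.

The resultant is a combination of F and G with integral coefficients. Hence applying the lift to a
pair of forms shrinks its norm by no more than the resultant: ‖(F(p, r), G(p, r))‖ ≥ |Res| ‖(p,
r)‖^d (`resultant_mul_pow_le`). Iteration sums a geometric series: the lift of φ^n loses at most
|Res|^((N-1)/(d-1)) (`logb_pairNorm_iterLift`).

Take for (p, r) the rows of a matrix γ. The function ordRes of a conjugate is explicit in det γ and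
the norm of the conjugated lift (`ordRes_conj`), so the value for φ^n at γ(ζ_G) exceeds the value at
ζ_G by at least N(N-1)(ρ(ζ_G, γ(ζ_G)) - R) (`le_ordRes_conj_iter`, `le_ordResII_iter`). Since N > 1,
a point farther than R cannot be a minimum, and R does not involve n.

This settles type II points. For the others, values on linear forms (`lin`) suffice: they determine
the diameter, they are nearly proportional for points close in the small metric
(`lin_mul_le_of_smallDist_lt`), and near proportionality bounds the change of ordRes
(`ordResII_le_of_lin_le`). So the limit defining the extension is finite where the diameter is
positive (`exists_tendsto_ordResII`), while the lower bound makes it ∞ where the diameter is 0. The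
inequality then passes to the limit (`diamG_of_mem_minResLoc`). -/

noncomputable section

namespace Berk

/-! ### Binary forms of a fixed formal degree, evaluated at pairs. -/

section Heval

variable {K : Type*} [Field K] {A : Type*} [CommRing A] [Algebra K A]

/-- The value at `(p, q)` of the binary form of degree `d` with dehomogenization `F`. -/
def heval (d : ℕ) (F : K[X]) (p q : A) : A := MvPolynomial.aeval ![p, q] (F.homogenize d)

lemma heval_eq_sum (d : ℕ) (F : K[X]) (p q : A) :
    heval d F p q = ∑ i ∈ Finset.range (d + 1), algebraMap K A (F.coeff i) * (p ^ i * q ^ (d - i)) := by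
  rw [heval, homogenize, map_sum, Finset.Nat.sum_antidiagonal_eq_sum_range_succ_mk]
  refine Finset.sum_congr rfl fun i _ => ?_
  rw [MvPolynomial.aeval_monomial, Finsupp.prod_fintype _ _ (by simp)]
  simp

lemma heval_add (d : ℕ) (F G : K[X]) (p q : A) :
    heval d (F + G) p q = heval d F p q + heval d G p q := by
  simp [heval]

lemma heval_C_mul (d : ℕ) (c : K) (F : K[X]) (p q : A) :
    heval d (C c * F) p q = algebraMap K A c * heval d F p q := by
  simp [heval]

lemma heval_mul {m n : ℕ} {F G : K[X]} (hF : F.natDegree ≤ m) (hG : G.natDegree ≤ n) (p q : A) :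
    heval (m + n) (F * G) p q = heval m F p q * heval n G p q := by
  simp [heval, homogenize_mul F G hF hG]

lemma heval_C (d : ℕ) (c : K) (p q : A) : heval d (C c) p q = algebraMap K A c * q ^ d := by
  simp [heval]

lemma heval_pow {m : ℕ} {F : K[X]} (hF : F.natDegree ≤ m) (i : ℕ) (p q : A) :
    heval (i * m) (F ^ i) p q = heval m F p q ^ i := by
  induction i with
  | zero => simpa using heval_C 0 (1 : K) p q
  | succ i ih =>
    rw [pow_succ, add_mul, one_mul, heval_mul (natDegree_pow_le_of_le i hF) hF, ih, pow_succ]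

lemma heval_linear (a b : K) (p q : A) :
    heval 1 (C a * X + C b) p q = algebraMap K A a * p + algebraMap K A b * q := by
  rw [heval_add, heval_C_mul, heval_C, heval, homogenize_X one_ne_zero]
  simp

lemma map_heval {B : Type*} [CommRing B] [Algebra K B] (f : A →ₐ[K] B) (d : ℕ) (F : K[X])
    (p q : A) : f (heval d F p q) = heval d F (f p) (f q) := by
  simp [heval_eq_sum]

lemma heval_mul_mul (d : ℕ) (F : K[X]) (c p q : A) :
    heval d F (c * p) (c * q) = c ^ d * heval d F p q := by
  rw [heval_eq_sum, heval_eq_sum, Finset.mul_sum]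
  refine Finset.sum_congr rfl fun i hi => ?_
  have : c ^ d = c ^ i * c ^ (d - i) := by
    rw [← pow_add, Nat.add_sub_cancel' (Nat.lt_succ_iff.mp (Finset.mem_range.mp hi))]
  rw [this, mul_pow, mul_pow]
  ring

lemma heval_one_right {d : ℕ} {F : K[X]} (hF : F.natDegree ≤ d) (p : A) :
    heval d F p 1 = aeval p F := by
  rw [heval, aeval_homogenize_of_eq_one hF] <;> simp

lemma heval_X_one {d : ℕ} {F : K[X]} (hF : F.natDegree ≤ d) : heval d F (X : K[X]) 1 = F := by
  rw [heval_one_right hF, aeval_X_left_apply]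

lemma heval_div {L : Type*} [Field L] [Algebra K L] {d : ℕ} {F : K[X]} (hF : F.natDegree ≤ d)
    (p : L) {q : L} (hq : q ≠ 0) : heval d F p q = q ^ d * aeval (p / q) F := by
  rw [← heval_one_right hF, ← heval_mul_mul, mul_div_cancel₀ _ hq, mul_one]

lemma heval_one_zero (d : ℕ) (F : K[X]) : heval d F (1 : K) 0 = F.coeff d := by
  rw [heval_eq_sum, Finset.sum_eq_single d]
  · simp
  · intro i hi hid
    have : d - i ≠ 0 := by have := Finset.mem_range.mp hi; omega
    simp [this]
  · simp

lemma natDegree_heval_le {d e : ℕ} (F : K[X]) {P Q : K[X]} (hP : P.natDegree ≤ e)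
    (hQ : Q.natDegree ≤ e) : (heval d F P Q).natDegree ≤ d * e := by
  rw [heval_eq_sum]
  refine natDegree_sum_le_of_forall_le _ _ fun i hi => ?_
  have hi : i ≤ d := Nat.lt_succ_iff.mp (Finset.mem_range.mp hi)
  rw [algebraMap_eq]
  refine (natDegree_C_mul_le _ _).trans (natDegree_mul_le.trans ?_)
  calc _ ≤ i * e + (d - i) * e :=
        add_le_add (natDegree_pow_le_of_le i hP) (natDegree_pow_le_of_le _ hQ)
    _ = d * e := by rw [← add_mul, Nat.add_sub_cancel' hi]

/-- Composition of homogeneous maps; it turns the value of an iterated lift into repeated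
evaluation. -/
lemma heval_heval {d e : ℕ} (F : K[X]) {P Q : K[X]} (hP : P.natDegree ≤ e)
    (hQ : Q.natDegree ≤ e) (p q : A) :
    heval (d * e) (heval d F P Q) p q = heval d F (heval e P p q) (heval e Q p q) := by
  rw [heval_eq_sum d F P, heval_eq_sum d F (heval e P p q)]
  have key : ∀ s : Finset ℕ, ∀ f : ℕ → K[X],
      heval (d * e) (∑ i ∈ s, f i) p q = ∑ i ∈ s, heval (d * e) (f i) p q := by
    intro s f
    simp [heval, map_sum]
  rw [key]
  refine Finset.sum_congr rfl fun i hi => ?_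
  have hi : i ≤ d := Nat.lt_succ_iff.mp (Finset.mem_range.mp hi)
  rw [algebraMap_eq, heval_C_mul, ← heval_pow hP, ← heval_pow hQ, ← heval_mul
    (natDegree_pow_le_of_le i hP) (natDegree_pow_le_of_le _ hQ), ← add_mul,
    Nat.add_sub_cancel' hi]

end Heval

/-! ### Resultants under linear changes of source and target coordinates. -/

section Resultant

variable {K : Type*} [Field K]

/-- Formal degree in excess of the true one only contributes powers of `f.coeff m`, and these
multiply. -/
lemma resultant_mul_right_of_le {f g₁ g₂ : K[X]} {m n₁ n₂ : ℕ} (hf : f.natDegree ≤ m)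
    (h₁ : g₁.natDegree ≤ n₁) (h₂ : g₂.natDegree ≤ n₂) :
    resultant f (g₁ * g₂) m (n₁ + n₂) = resultant f g₁ m n₁ * resultant f g₂ m n₂ := by
  obtain ⟨k₁, rfl⟩ := Nat.exists_eq_add_of_le h₁
  obtain ⟨k₂, rfl⟩ := Nat.exists_eq_add_of_le h₂
  rw [add_add_add_comm, resultant_add_right_deg _ _ _ _ _ natDegree_mul_le,
    resultant_add_right_deg _ _ _ _ _ le_rfl, resultant_add_right_deg _ _ _ _ _ le_rfl,
    resultant_mul_right _ _ _ _ hf]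
  ring

lemma resultant_mul_left_of_le {f₁ f₂ g : K[X]} {m₁ m₂ n : ℕ} (hg : g.natDegree ≤ n)
    (h₁ : f₁.natDegree ≤ m₁) (h₂ : f₂.natDegree ≤ m₂) :
    resultant (f₁ * f₂) g (m₁ + m₂) n = resultant f₁ g m₁ n * resultant f₂ g m₂ n := by
  rw [resultant_comm, resultant_mul_right_of_le hg h₁ h₂, resultant_comm f₁, resultant_comm f₂,
    add_mul, pow_add]
  ring

/-- The zero of aX + bY is (-b : a); for a = 0 it is the point at infinity, where the form takes its
top coefficient. -/
lemma resultant_linear_left (a b : K) {g : K[X]} {n : ℕ} (hg : g.natDegree ≤ n) :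
    resultant (C a * X + C b) g 1 n = heval n g (-b) a := by
  by_cases ha : a = 0
  · have := heval_mul_mul n g (-b) (1 : K) 0
    rw [mul_one, mul_zero, heval_one_zero] at this
    rw [ha, this, C_0, zero_mul, zero_add, resultant_C_left, neg_pow b]
    ring
  · have : C a * X + C b = C a * (X + C (b / a)) := by
      rw [mul_add, ← C_mul, mul_div_cancel₀ _ ha]
    rw [this, resultant_C_mul_left, resultant_X_add_C_left _ _ _ hg, heval_div hg _ ha,
      coe_aeval_eq_eval, neg_div]

/-- The substitution of `(aX+bY, cX+dY)` in a binary form of degree `n`. -/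
def subst (n : ℕ) (γ : Matrix (Fin 2) (Fin 2) K) (f : K[X]) : K[X] :=
  heval n f (C (γ 0 0) * X + C (γ 0 1)) (C (γ 1 0) * X + C (γ 1 1))

lemma natDegree_subst_le (n : ℕ) (γ : Matrix (Fin 2) (Fin 2) K) (f : K[X]) :
    (subst n γ f).natDegree ≤ n := by
  simpa [subst] using natDegree_heval_le (d := n) f (natDegree_linear_le (a := γ 0 0) (b := γ 0 1))
    (natDegree_linear_le (a := γ 1 0) (b := γ 1 1))

lemma heval_subst {A : Type*} [CommRing A] [Algebra K A] (n : ℕ) (γ : Matrix (Fin 2) (Fin 2) K)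
    (f : K[X]) (p q : A) : heval n (subst n γ f) p q =
      heval n f (algebraMap K A (γ 0 0) * p + algebraMap K A (γ 0 1) * q)
        (algebraMap K A (γ 1 0) * p + algebraMap K A (γ 1 1) * q) := by
  have := heval_heval (d := n) f (natDegree_linear_le (a := γ 0 0) (b := γ 0 1))
    (natDegree_linear_le (a := γ 1 0) (b := γ 1 1)) p q
  rwa [mul_one, heval_linear, heval_linear] at this

lemma subst_mul {m n : ℕ} {f g : K[X]} (hf : f.natDegree ≤ m) (hg : g.natDegree ≤ n)
    (γ : Matrix (Fin 2) (Fin 2) K) : subst (m + n) γ (f * g) = subst m γ f * subst n γ g :=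
  heval_mul hf hg _ _

lemma subst_linear (a b : K) (γ : Matrix (Fin 2) (Fin 2) K) :
    subst 1 γ (C a * X + C b) =
      C (a * γ 0 0 + b * γ 1 0) * X + C (a * γ 0 1 + b * γ 1 1) := by
  rw [subst, heval_linear]
  simp only [algebraMap_eq, C_add, C_mul]
  ring

lemma subst_subst (n : ℕ) (γ δ : Matrix (Fin 2) (Fin 2) K) (f : K[X]) :
    subst n δ (subst n γ f) = subst n (γ * δ) f := by
  rw [subst, heval_subst]
  simp only [subst, algebraMap_eq, Matrix.mul_apply, Fin.sum_univ_two, C_add, C_mul]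
  congr 1 <;> ring

lemma subst_one {n : ℕ} {f : K[X]} (hf : f.natDegree ≤ n) : subst n 1 f = f := by
  simpa [subst] using heval_X_one hf

/-- Over an algebraically closed field, a binary form is a product of linear forms. -/
lemma linear_form_induction [IsAlgClosed K] (P : ℕ → K[X] → Prop) (hC : ∀ c, P 0 (C c))
    (hlin : ∀ a b, P 1 (C a * X + C b))
    (hmul : ∀ m n f g, f.natDegree ≤ m → g.natDegree ≤ n → P m f → P n g → P (m + n) (f * g))
    {n : ℕ} {f : K[X]} (hf : f.natDegree ≤ n) : P n f := by
  induction n generalizing f with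
  | zero =>
    rw [eq_C_of_natDegree_le_zero hf]
    exact hC _
  | succ n ih =>
    by_cases h : f.natDegree ≤ n
    · have := hmul n 1 f (C 0 * X + C 1) h natDegree_linear_le (ih h) (hlin 0 1)
      simpa using this
    · obtain ⟨a, ha⟩ := IsAlgClosed.exists_root f (by
        intro h0
        exact h (by rw [natDegree_eq_of_degree_eq_some h0]; exact Nat.zero_le _))
      obtain ⟨g, rfl⟩ := dvd_iff_isRoot.mpr ha
      have hg : g.natDegree ≤ n := by
        by_cases hg : g = 0
        · simp [hg]
        · rw [natDegree_mul (X_sub_C_ne_zero a) hg, natDegree_X_sub_C] at hf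
          omega
      have := hmul n 1 g (C 1 * X + C (-a)) hg natDegree_linear_le (ih hg) (hlin 1 (-a))
      convert this using 1
      simp only [C_1, one_mul, C_neg]
      ring

/-- By multiplicativity only a linear f matters. If (-b', a') is the zero of the transformed linear
form, then γ(-b', a') = det γ · (-b, a), and homogeneity of g gives the power of det γ. -/
lemma resultant_subst [IsAlgClosed K] (γ : Matrix (Fin 2) (Fin 2) K) {m n : ℕ} {f g : K[X]}
    (hf : f.natDegree ≤ m) (hg : g.natDegree ≤ n) :
    resultant (subst m γ f) (subst n γ g) m n = γ.det ^ (m * n) * resultant f g m n := by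
  refine linear_form_induction (fun m f => resultant (subst m γ f) (subst n γ g) m n =
    γ.det ^ (m * n) * resultant f g m n) (fun c => ?_) (fun a b => ?_) ?_ hf
  · simp [subst, heval_C]
  · rw [subst_linear, resultant_linear_left _ _ hg,
      resultant_linear_left _ _ (natDegree_subst_le _ _ _), heval_subst, one_mul,
      ← heval_mul_mul, Matrix.det_fin_two]
    simp only [Algebra.algebraMap_self, RingHom.id_apply]
    congr 1 <;> ring
  · intro m₁ m₂ f₁ f₂ h₁ h₂ e₁ e₂
    rw [subst_mul h₁ h₂, resultant_mul_left_of_le (natDegree_subst_le _ _ _)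
      (natDegree_subst_le _ _ _) (natDegree_subst_le _ _ _), e₁, e₂,
      resultant_mul_left_of_le hg h₁ h₂, add_mul, pow_add]
    ring

/-- Gaussian elimination on γ: adding a multiple of one form to the other leaves the resultant
unchanged, and scaling a form contributes a d-th power. -/
lemma resultant_linear_combination (γ : Matrix (Fin 2) (Fin 2) K) {d : ℕ} {F G : K[X]}
    (hF : F.natDegree ≤ d) (hG : G.natDegree ≤ d) :
    resultant (C (γ 0 0) * F + C (γ 0 1) * G) (C (γ 1 0) * F + C (γ 1 1) * G) d d =
      γ.det ^ d * resultant F G d d := by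
  by_cases h : γ 0 0 = 0
  · have e : C (γ 1 0) * F + C (γ 1 1) * G = C (γ 1 0) * F + G * C (γ 1 1) := by ring
    rw [h, C_0, zero_mul, zero_add, resultant_C_mul_left, e,
      resultant_add_mul_right _ _ _ _ _ (by simp) hG, resultant_C_mul_right, resultant_comm,
      Matrix.det_fin_two, h, zero_mul, zero_sub, ← mul_neg, mul_pow, neg_pow (γ 1 0), pow_mul]
    -- The sign from exchanging the two forms is (-1)^(d²), and d² has the parity of d.
    have : ((-1 : K) ^ d) ^ d = (-1) ^ d := by
      rw [← pow_mul, neg_one_pow_eq_pow_mod_two, neg_one_pow_eq_pow_mod_two (n := d)]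
      congr 1
      rcases Nat.mod_two_eq_zero_or_one d with h | h <;> simp [Nat.mul_mod, h]
    rw [this]
    ring
  · have e : C (γ 1 0) * F + C (γ 1 1) * G = C (γ.det / γ 0 0) * G +
        (C (γ 0 0) * F + C (γ 0 1) * G) * C (γ 1 0 / γ 0 0) := by
      have h1 : γ 1 0 = γ 0 0 * (γ 1 0 / γ 0 0) := by field_simp
      have h2 : γ 1 1 = γ.det / γ 0 0 + γ 0 1 * (γ 1 0 / γ 0 0) := by
        rw [Matrix.det_fin_two]; field_simp; ring
      nth_rewrite 1 [h1, h2]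
      simp only [C_add, C_mul]
      ring
    have hd : (C (γ 0 0) * F + C (γ 0 1) * G).natDegree ≤ d :=
      natDegree_add_le_of_degree_le ((natDegree_C_mul_le _ _).trans hF)
        ((natDegree_C_mul_le _ _).trans hG)
    have e' : C (γ 0 0) * F + C (γ 0 1) * G = C (γ 0 0) * F + G * C (γ 0 1) := by ring
    rw [e, resultant_add_mul_right _ _ _ _ _ (by simp) hd, resultant_C_mul_right, e',
      resultant_add_mul_left _ _ _ _ _ (by simp) hG, resultant_C_mul_left, div_pow]
    field_simp

end Resultant

/-! ### Pairs of forms without a common zero. -/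

section NonDeg

variable {K : Type*} [Field K]

/-- The binary forms of degree `d` given by `F` and `G` have no common zero, so that `F / G` is a
rational function of degree `d`. -/
structure NonDegenerate (d : ℕ) (F G : K[X]) : Prop where
  left : F.natDegree ≤ d
  right : G.natDegree ≤ d
  ne : ∀ x y : K, heval d F x y = 0 → heval d G x y = 0 → x = 0 ∧ y = 0

lemma exists_heval_eq_zero [IsAlgClosed K] {d : ℕ} (hd : 1 ≤ d) {F : K[X]} (hF : F.natDegree ≤ d) :
    ∃ x y : K, heval d F x y = 0 ∧ ¬ (x = 0 ∧ y = 0) := by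
  by_cases h : F.coeff d = 0
  · exact ⟨1, 0, by rw [heval_one_zero, h], by simp⟩
  · have hdeg : F.natDegree = d := le_antisymm hF (le_natDegree_of_ne_zero h)
    obtain ⟨a, ha⟩ := IsAlgClosed.exists_root F (by
      intro h0
      have : F.natDegree = 0 := natDegree_eq_of_degree_eq_some h0
      omega)
    exact ⟨a, 1, by rw [heval_one_right hF, coe_aeval_eq_eval]; exact ha, by simp⟩

lemma heval_zero (d : ℕ) {A : Type*} [CommRing A] [Algebra K A] (p q : A) :
    heval d (0 : K[X]) p q = 0 := by
  simp [heval]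

lemma NonDegenerate.right_ne_zero [IsAlgClosed K] {d : ℕ} (hd : 1 ≤ d) {F G : K[X]}
    (h : NonDegenerate d F G) : G ≠ 0 := by
  rintro rfl
  obtain ⟨x, y, hxy, hne⟩ := exists_heval_eq_zero hd h.left
  exact hne (h.ne x y hxy (heval_zero _ _ _))

lemma NonDegenerate.isCoprime [IsAlgClosed K] {d : ℕ} {F G : K[X]}
    (h : NonDegenerate d F G) : IsCoprime F G := by
  rw [isCoprime_iff_aeval_ne_zero_of_isAlgClosed K K]
  intro a
  by_contra! hc
  have := h.ne a 1 (by rw [heval_one_right h.left, hc.1]) (by rw [heval_one_right h.right, hc.2])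
  simp at this

lemma NonDegenerate.natDegree_eq {d : ℕ} {F G : K[X]} (h : NonDegenerate d F G) :
    F.natDegree = d ∨ G.natDegree = d := by
  by_contra! hc
  have h1 : F.coeff d = 0 := coeff_eq_zero_of_natDegree_lt (lt_of_le_of_ne h.left hc.1)
  have h2 : G.coeff d = 0 := coeff_eq_zero_of_natDegree_lt (lt_of_le_of_ne h.right hc.2)
  have := h.ne 1 0 (by rw [heval_one_zero, h1]) (by rw [heval_one_zero, h2])
  simp at this

/-- Coprimality excludes common zeros in the affine line; a common zero at infinity would make both
top coefficients vanish, against the choice of d. -/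
lemma NonDegenerate.of_isCoprime {d : ℕ} {F G : K[X]} (hc : IsCoprime F G)
    (hd : max F.natDegree G.natDegree = d) : NonDegenerate d F G := by
  have hF : F.natDegree ≤ d := hd ▸ le_max_left _ _
  have hG : G.natDegree ≤ d := hd ▸ le_max_right _ _
  refine ⟨hF, hG, fun x y h1 h2 => ?_⟩
  by_cases hy : y = 0
  · refine ⟨?_, hy⟩
    by_contra hx
    have key : ∀ f : K[X], heval d f x y = x ^ d * f.coeff d := by
      intro f
      have := heval_mul_mul d f x (1 : K) 0
      rwa [mul_one, mul_zero, ← hy, hy, heval_one_zero, ← hy] at this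
    rw [key, mul_eq_zero, or_iff_right (pow_ne_zero _ hx)] at h1 h2
    rcases max_choice F.natDegree G.natDegree with h | h <;> rw [hd] at h
    · rw [h, coeff_natDegree, leadingCoeff_eq_zero] at h1
      have : G.natDegree = 0 := by
        have := isCoprime_zero_left.mp (h1 ▸ hc)
        exact natDegree_eq_zero_of_isUnit this
      rw [h1, natDegree_zero] at h
      rw [h1, isCoprime_zero_left] at hc
      rw [h, ← this, coeff_natDegree, leadingCoeff_eq_zero] at h2
      exact hc.ne_zero h2
    · rw [h, coeff_natDegree, leadingCoeff_eq_zero] at h2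
      have : F.natDegree = 0 := by
        have := isCoprime_zero_right.mp (h2 ▸ hc)
        exact natDegree_eq_zero_of_isUnit this
      rw [h2, natDegree_zero] at h
      rw [h2, isCoprime_zero_right] at hc
      rw [h, ← this, coeff_natDegree, leadingCoeff_eq_zero] at h1
      exact hc.ne_zero h1
  · exfalso
    rw [heval_div hF _ hy, mul_eq_zero, or_iff_right (pow_ne_zero _ hy)] at h1
    rw [heval_div hG _ hy, mul_eq_zero, or_iff_right (pow_ne_zero _ hy)] at h2
    obtain ⟨a, b, hab⟩ := hc
    have := congrArg (aeval (x / y)) hab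
    rw [map_add, map_mul, map_mul, h1, h2] at this
    simp at this

/-- One form has true degree d, so passing from true to formal degrees multiplies the resultant by a
power of its leading coefficient, up to sign. -/
lemma NonDegenerate.resultant_ne_zero [IsAlgClosed K] {d : ℕ} {F G : K[X]}
    (h : NonDegenerate d F G) : resultant F G d d ≠ 0 := by
  have hR := Polynomial.resultant_ne_zero F G h.isCoprime
  rcases h.natDegree_eq with hF | hG
  · obtain ⟨k, hk⟩ := Nat.exists_eq_add_of_le h.right
    have h2 : resultant F G d d = resultant F G F.natDegree (G.natDegree + k) := by rw [hF, ← hk]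
    rw [h2, resultant_add_right_deg _ _ _ _ _ le_rfl]
    by_cases hF0 : F = 0
    · have : d = 0 := by rw [← hF, hF0, natDegree_zero]
      have : k = 0 := by omega
      rw [this, pow_zero, one_mul]
      exact hR
    · exact mul_ne_zero (pow_ne_zero _ (by simpa using hF0)) hR
  · obtain ⟨k, hk⟩ := Nat.exists_eq_add_of_le h.left
    have h2 : resultant F G d d = resultant F G (F.natDegree + k) G.natDegree := by rw [hG, ← hk]
    rw [h2, resultant_add_left_deg _ _ _ _ _ le_rfl]
    by_cases hG0 : G = 0
    · have : d = 0 := by rw [← hG, hG0, natDegree_zero]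
      have : k = 0 := by omega
      simpa [this] using hR
    · exact mul_ne_zero (mul_ne_zero (by simp) (pow_ne_zero _ (by simpa using hG0))) hR

lemma NonDegenerate.linear_combination_ne_zero [IsAlgClosed K] {e : ℕ} (he : 1 ≤ e) {P Q : K[X]}
    (h : NonDegenerate e P Q) {a b : K} (hab : ¬ (a = 0 ∧ b = 0)) :
    C a * P + C b * Q ≠ 0 := by
  intro h0
  have key : ∀ x y : K, a * heval e P x y + b * heval e Q x y = 0 := by
    intro x y
    have := congrArg (fun f => heval e f x y) h0
    simpa [heval_add, heval_C_mul, heval_zero] using this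
  by_cases ha : a = 0
  · obtain ⟨x, y, hxy, hne⟩ := exists_heval_eq_zero he h.left
    have h1 := key x y
    rw [hxy, mul_zero, zero_add, mul_eq_zero, or_iff_right (fun hb => hab ⟨ha, hb⟩)] at h1
    exact hne (h.ne x y hxy h1)
  · obtain ⟨x, y, hxy, hne⟩ := exists_heval_eq_zero he h.right
    have h1 := key x y
    rw [hxy, mul_zero, add_zero, mul_eq_zero, or_iff_right ha] at h1
    exact hne (h.ne x y h1 hxy)

/-- Factor G into linear forms. Each factor becomes a combination of P and Q, nonzero because
otherwise a zero of one of them would be a common zero. This keeps denominators of compositions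
nonzero. -/
lemma NonDegenerate.heval_ne_zero [IsAlgClosed K] {e : ℕ} (he : 1 ≤ e) {P Q : K[X]}
    (h : NonDegenerate e P Q) {d : ℕ} {G : K[X]} (hG : G.natDegree ≤ d) (hG0 : G ≠ 0) :
    heval d G P Q ≠ 0 := by
  revert hG0
  refine linear_form_induction (fun d G => G ≠ 0 → heval d G P Q ≠ 0) (fun c hc => ?_)
    (fun a b hab => ?_) ?_ hG
  · simpa [heval_C] using hc
  · rw [heval_linear]
    refine h.linear_combination_ne_zero he ?_
    rintro ⟨rfl, rfl⟩
    simp at hab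
  · intro m n f g hf hg h1 h2 h3
    rw [heval_mul hf hg]
    exact mul_ne_zero (h1 (left_ne_zero_of_mul h3)) (h2 (right_ne_zero_of_mul h3))

lemma NonDegenerate.comp {d e : ℕ} {F G P Q : K[X]} (h : NonDegenerate d F G)
    (h' : NonDegenerate e P Q) :
    NonDegenerate (d * e) (heval d F P Q) (heval d G P Q) := by
  refine ⟨natDegree_heval_le F h'.left h'.right, natDegree_heval_le G h'.left h'.right,
    fun x y h1 h2 => ?_⟩
  rw [heval_heval _ h'.left h'.right] at h1 h2
  obtain ⟨h3, h4⟩ := h.ne _ _ h1 h2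
  exact h'.ne x y h3 h4

lemma nonDegenerate_linear (γ : Matrix (Fin 2) (Fin 2) K) (hγ : γ.det ≠ 0) :
    NonDegenerate 1 (C (γ 0 0) * X + C (γ 0 1)) (C (γ 1 0) * X + C (γ 1 1)) := by
  refine ⟨natDegree_linear_le, natDegree_linear_le, fun x y h1 h2 => ?_⟩
  rw [heval_linear, Algebra.algebraMap_self, RingHom.id_apply, RingHom.id_apply] at h1 h2
  rw [Matrix.det_fin_two] at hγ
  constructor
  · have : (γ 0 0 * γ 1 1 - γ 0 1 * γ 1 0) * x = 0 := by
      linear_combination γ 1 1 * h1 - γ 0 1 * h2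
    exact (mul_eq_zero.mp this).resolve_left hγ
  · have : (γ 0 0 * γ 1 1 - γ 0 1 * γ 1 0) * y = 0 := by
      linear_combination γ 0 0 * h2 - γ 1 0 * h1
    exact (mul_eq_zero.mp this).resolve_left hγ

end NonDeg

/-! ### Rational functions as quotients of forms: composition, conjugation, iteration. -/

section RatFunc

variable {K : Type*} [NontriviallyNormedField K]

/-- The rational function `F / G`. -/
def ratio (F G : K[X]) : RatFunc K := algebraMap K[X] (RatFunc K) F / algebraMap K[X] (RatFunc K) G

lemma algebraMap_ne_zero {G : K[X]} (hG : G ≠ 0) : algebraMap K[X] (RatFunc K) G ≠ 0 := by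
  simpa using hG

lemma num_mul_eq {F G : K[X]} (hG : G ≠ 0) :
    (ratio F G).num * G = F * (ratio F G).denom := by
  apply IsFractionRing.injective K[X] (RatFunc K)
  have h := RatFunc.num_div_denom (ratio F G)
  nth_rewrite 3 [ratio] at h
  rw [div_eq_div_iff (algebraMap_ne_zero (RatFunc.denom_ne_zero _)) (algebraMap_ne_zero hG)] at h
  rw [map_mul, map_mul, h]

/-- The common factor cancelled in F / G has degree 0, since cancelling it does not lower the
degree. -/
lemma exists_eq_C_mul_num {F G : K[X]} (hG : G ≠ 0)
    (hd : max F.natDegree G.natDegree ≤ deg (ratio F G)) :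
    ∃ c : K, c ≠ 0 ∧ F = C c * (ratio F G).num ∧ G = C c * (ratio F G).denom := by
  set φ := ratio F G with hφ
  have h := num_mul_eq (F := F) hG
  rw [← hφ] at h
  have hcop := RatFunc.isCoprime_num_denom φ
  obtain ⟨c, hc⟩ : φ.denom ∣ G := hcop.symm.dvd_of_dvd_mul_left ⟨F, by rw [h, mul_comm]⟩
  have hF : F = φ.num * c := by
    have : φ.denom * F = φ.denom * (φ.num * c) := by
      rw [mul_comm, ← h, hc]; ring
    exact mul_left_cancel₀ φ.denom_ne_zero this
  have hc0 : c ≠ 0 := by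
    rintro rfl
    exact hG (by rw [hc, mul_zero])
  have hdeg : c.natDegree = 0 := by
    have hGd : G.natDegree = φ.denom.natDegree + c.natDegree := by
      conv_lhs => rw [hc, natDegree_mul φ.denom_ne_zero hc0]
    rcases max_choice φ.num.natDegree φ.denom.natDegree with hm | hm <;> rw [deg, hm] at hd
    · by_cases hn : φ.num = 0
      · rw [hn, natDegree_zero] at hd
        have := (le_max_right _ _).trans hd
        omega
      · have hFd : F.natDegree = φ.num.natDegree + c.natDegree := by
          conv_lhs => rw [hF, natDegree_mul hn hc0]
        have := (le_max_left _ _).trans hd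
        omega
    · have := (le_max_right _ _).trans hd
      omega
  rw [natDegree_eq_zero] at hdeg
  obtain ⟨a, rfl⟩ := hdeg
  exact ⟨a, by simpa using hc0, by rw [mul_comm, ← hF], by rw [mul_comm, ← hc]⟩

lemma nonDegenerate_num_denom (φ : RatFunc K) : NonDegenerate (deg φ) φ.num φ.denom :=
  .of_isCoprime (RatFunc.isCoprime_num_denom φ) rfl

lemma NonDegenerate.const_mul {d : ℕ} {F G : K[X]} (h : NonDegenerate d F G) {c : K} (hc : c ≠ 0) :
    NonDegenerate d (C c * F) (C c * G) := by
  refine ⟨(natDegree_C_mul_le _ _).trans h.left, (natDegree_C_mul_le _ _).trans h.right,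
    fun x y h1 h2 => h.ne x y ?_ ?_⟩
  · simpa [heval_C_mul, hc] using h1
  · simpa [heval_C_mul, hc] using h2

lemma nonDegenerate_of_isNormalizedLift {φ : RatFunc K} {F G : K[X]}
    (h : IsNormalizedLift φ F G) : NonDegenerate (deg φ) F G := by
  have hφ : ratio F G = φ := h.eq_div.symm
  obtain ⟨c, hc, h1, h2⟩ := exists_eq_C_mul_num h.right_ne_zero
    (by rw [hφ]; exact max_le h.natDegree_left h.natDegree_right)
  rw [hφ] at h1 h2
  rw [h1, h2]
  exact (nonDegenerate_num_denom φ).const_mul hc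

lemma NonDegenerate.deg_ratio [IsAlgClosed K] {d : ℕ} (hd : 1 ≤ d) {F G : K[X]}
    (h : NonDegenerate d F G) : deg (ratio F G) = d := by
  have hG := h.right_ne_zero hd
  have e := num_mul_eq (F := F) hG
  set φ := ratio F G
  have hcop := RatFunc.isCoprime_num_denom φ
  have h1 : Associated F φ.num := associated_of_dvd_dvd
    (h.isCoprime.dvd_of_dvd_mul_right (by rw [e]; exact dvd_mul_right _ _))
    (hcop.dvd_of_dvd_mul_right (by rw [← e]; exact dvd_mul_right _ _))
  have h2 : Associated G φ.denom := associated_of_dvd_dvd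
    (h.isCoprime.symm.dvd_of_dvd_mul_left (by rw [← e]; exact dvd_mul_left _ _))
    (hcop.symm.dvd_of_dvd_mul_left (by rw [e]; exact dvd_mul_left _ _))
  rw [deg, ← natDegree_eq_of_degree_eq (degree_eq_degree_of_associated h1),
    ← natDegree_eq_of_degree_eq (degree_eq_degree_of_associated h2)]
  rcases h.natDegree_eq with h3 | h3
  · rw [h3]; exact max_eq_left h.right
  · rw [h3]; exact max_eq_right h.left

lemma NonDegenerate.exists_eq_C_mul [IsAlgClosed K] {d : ℕ} (hd : 1 ≤ d) {F G F' G' : K[X]}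
    (h : NonDegenerate d F G) (h' : NonDegenerate d F' G') (e : ratio F G = ratio F' G') :
    ∃ c : K, c ≠ 0 ∧ F' = C c * F ∧ G' = C c * G := by
  obtain ⟨a, ha, h1, h2⟩ := exists_eq_C_mul_num (F := F) (h.right_ne_zero hd)
    (by rw [h.deg_ratio hd]; exact max_le h.left h.right)
  obtain ⟨b, hb, h3, h4⟩ := exists_eq_C_mul_num (F := F') (h'.right_ne_zero hd)
    (by rw [h'.deg_ratio hd]; exact max_le h'.left h'.right)
  rw [← e] at h3 h4
  refine ⟨b / a, div_ne_zero hb ha, ?_, ?_⟩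
  · conv_rhs => rw [h1]
    rw [← mul_assoc, ← C_mul, div_mul_cancel₀ _ ha, ← h3]
  · conv_rhs => rw [h2]
    rw [← mul_assoc, ← C_mul, div_mul_cancel₀ _ ha, ← h4]

lemma comp_ratio [IsAlgClosed K] {d e : ℕ} (hd : 1 ≤ d) (he : 1 ≤ e) {F G P Q : K[X]}
    (h : NonDegenerate d F G) (h' : NonDegenerate e P Q) :
    comp (ratio F G) (ratio P Q) = ratio (heval d F P Q) (heval d G P Q) := by
  have hG := h.right_ne_zero hd
  have hQ := algebraMap_ne_zero (h'.right_ne_zero he)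
  have key : ∀ f : K[X], f.natDegree ≤ d → algebraMap K[X] (RatFunc K) (heval d f P Q) =
      algebraMap K[X] (RatFunc K) Q ^ d * aeval (ratio P Q) f := by
    intro f hf
    rw [ratio, ← heval_div hf _ hQ]
    exact map_heval (IsScalarTower.toAlgHom K K[X] (RatFunc K)) d f P Q
  have hG' : aeval (ratio P Q) G ≠ 0 := by
    have := algebraMap_ne_zero (h'.heval_ne_zero he h.right hG)
    rw [key G h.right] at this
    exact right_ne_zero_of_mul this
  have hr : ratio (heval d F P Q) (heval d G P Q) =
      aeval (ratio P Q) F / aeval (ratio P Q) G := by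
    rw [ratio, key F h.left, key G h.right, mul_div_mul_left _ _ (pow_ne_zero _ hQ)]
  rw [hr, comp, RatFunc.eval]
  have hnum := congrArg (aeval (ratio P Q)) (num_mul_eq (F := F) hG)
  rw [map_mul, map_mul] at hnum
  have hden : aeval (ratio P Q) (ratio F G).denom ≠ 0 := by
    intro h0
    have hdvd : (ratio F G).denom ∣ G :=
      (RatFunc.isCoprime_num_denom _).symm.dvd_of_dvd_mul_left
        (by rw [num_mul_eq hG]; exact dvd_mul_left _ _)
    obtain ⟨c, hc⟩ := hdvd
    apply hG'
    rw [hc, map_mul, h0, zero_mul]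
  rw [← RatFunc.algebraMap_eq_C, ← aeval_def, ← aeval_def, div_eq_div_iff hden hG', hnum]

lemma mobius_eq_ratio (γ : GL (Fin 2) K) : mobius γ =
    ratio (C (γ 0 0) * X + C (γ 0 1)) (C (γ 1 0) * X + C (γ 1 1)) := by
  simp [mobius, ratio]

/-- The numerator of `γ⁻¹ ∘ (F / G) ∘ γ`, as a form of degree `d`. -/
def conjLeft (d : ℕ) (γ : GL (Fin 2) K) (F G : K[X]) : K[X] :=
  C (γ⁻¹ 0 0) * subst d γ F + C (γ⁻¹ 0 1) * subst d γ G

/-- The denominator of `γ⁻¹ ∘ (F / G) ∘ γ`, as a form of degree `d`. -/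
def conjRight (d : ℕ) (γ : GL (Fin 2) K) (F G : K[X]) : K[X] :=
  C (γ⁻¹ 1 0) * subst d γ F + C (γ⁻¹ 1 1) * subst d γ G

lemma det_ne_zero (γ : GL (Fin 2) K) : (γ : Matrix (Fin 2) (Fin 2) K).det ≠ 0 :=
  (Matrix.isUnit_iff_isUnit_det _).mp γ.isUnit |>.ne_zero

lemma NonDegenerate.subst {d : ℕ} {F G : K[X]} (h : NonDegenerate d F G) (γ : GL (Fin 2) K) :
    NonDegenerate d (subst d γ F) (subst d γ G) := by
  have := h.comp (nonDegenerate_linear (γ : Matrix (Fin 2) (Fin 2) K) (det_ne_zero γ))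
  rwa [mul_one] at this

lemma NonDegenerate.conj {d : ℕ} {F G : K[X]} (h : NonDegenerate d F G) (γ : GL (Fin 2) K) :
    NonDegenerate d (conjLeft d γ F G) (conjRight d γ F G) := by
  have := (nonDegenerate_linear (γ⁻¹ : GL (Fin 2) K).1 (det_ne_zero γ⁻¹)).comp (h.subst γ)
  rwa [one_mul, heval_linear, heval_linear] at this

lemma conj_ratio [IsAlgClosed K] {d : ℕ} (hd : 1 ≤ d) {F G : K[X]} (h : NonDegenerate d F G)
    (γ : GL (Fin 2) K) :
    conj (ratio F G) γ = ratio (conjLeft d γ F G) (conjRight d γ F G) := by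
  have e₁ := comp_ratio hd le_rfl h
    (nonDegenerate_linear (γ : Matrix (Fin 2) (Fin 2) K) (det_ne_zero γ))
  have e₂ := comp_ratio le_rfl hd (nonDegenerate_linear (γ⁻¹ : GL (Fin 2) K).1 (det_ne_zero γ⁻¹))
    (h.subst γ)
  rw [heval_linear, heval_linear] at e₂
  rw [Berk.conj, mobius_eq_ratio, mobius_eq_ratio]
  exact (congrArg _ e₁).trans e₂

lemma conj_one [IsAlgClosed K] {d : ℕ} (hd : 1 ≤ d) {F G : K[X]} (h : NonDegenerate d F G) :
    conj (ratio F G) 1 = ratio F G := by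
  rw [conj_ratio hd h]
  refine congrArg₂ ratio ?_ ?_
  · simp [conjLeft, subst_one h.left]
  · simp [conjRight, subst_one h.right]

lemma conj_conj [IsAlgClosed K] {d : ℕ} (hd : 1 ≤ d) {F G : K[X]} (h : NonDegenerate d F G) (γ δ : GL (Fin 2) K) :
    conj (conj (ratio F G) γ) δ = conj (ratio F G) (γ * δ) := by
  have key : ∀ a b : K, subst d δ.1 (C a * subst d γ.1 F + C b * subst d γ.1 G) =
      C a * subst d (γ * δ).1 F + C b * subst d (γ * δ).1 G := by
    intro a b
    rw [subst, heval_add, heval_C_mul, heval_C_mul, Units.val_mul, ← subst_subst, ← subst_subst]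
    rfl
  have hinv : ∀ i j, (γ * δ)⁻¹.1 i j = (δ⁻¹ : GL (Fin 2) K).1 i 0 * (γ⁻¹ : GL (Fin 2) K).1 0 j +
      (δ⁻¹ : GL (Fin 2) K).1 i 1 * (γ⁻¹ : GL (Fin 2) K).1 1 j := by
    intro i j
    rw [mul_inv_rev, Units.val_mul, Matrix.mul_apply, Fin.sum_univ_two]
  rw [conj_ratio hd h, conj_ratio hd (h.conj γ), conj_ratio hd h]
  refine congrArg₂ ratio ?_ ?_
  · rw [conjLeft, conjLeft, conjRight, key, key, conjLeft, hinv, hinv]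
    simp only [C_add, C_mul]
    ring
  · rw [conjRight, conjLeft, conjRight, key, key, conjRight, hinv, hinv]
    simp only [C_add, C_mul]
    ring

/-- Substituting γ contributes det γ to the power d², and composing with γ⁻¹ contributes its power
-d, here moved to the left. -/
lemma resultant_conj [IsAlgClosed K] {d : ℕ} {F G : K[X]} (hF : F.natDegree ≤ d)
    (hG : G.natDegree ≤ d) (γ : GL (Fin 2) K) :
    resultant (conjLeft d γ F G) (conjRight d γ F G) d d * (γ : Matrix (Fin 2) (Fin 2) K).det ^ d =
      (γ : Matrix (Fin 2) (Fin 2) K).det ^ (d * d) * resultant F G d d := by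
  have h := resultant_linear_combination (γ⁻¹ : GL (Fin 2) K).1 (natDegree_subst_le d γ F)
    (natDegree_subst_le d γ G)
  have hdet : (γ⁻¹ : GL (Fin 2) K).1.det * γ.1.det = 1 := by
    rw [← Matrix.det_mul, ← Units.val_mul, inv_mul_cancel, Units.val_one, Matrix.det_one]
  rw [conjLeft, conjRight, h, resultant_subst _ hF hG, mul_right_comm, ← mul_pow, hdet, one_pow,
    one_mul]

/-- The coordinates of the iterates of the map with coordinates `F`, `G`. -/
def iterLift (d : ℕ) (F G : K[X]) : ℕ → K[X] × K[X]
  | 0 => (X, 1)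
  | n + 1 => (heval d F (iterLift d F G n).1 (iterLift d F G n).2,
      heval d G (iterLift d F G n).1 (iterLift d F G n).2)

lemma NonDegenerate.iterLift {d : ℕ} {F G : K[X]} (h : NonDegenerate d F G) (n : ℕ) :
    NonDegenerate (d ^ n) (iterLift d F G n).1 (iterLift d F G n).2 := by
  induction n with
  | zero => simpa [Berk.iterLift] using nonDegenerate_linear (1 : Matrix (Fin 2) (Fin 2) K) (by simp)
  | succ n ih =>
    rw [pow_succ']
    exact h.comp ih

lemma iter_ratio [IsAlgClosed K] {d : ℕ} (hd : 1 ≤ d) {F G : K[X]} (h : NonDegenerate d F G)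
    (n : ℕ) : iter (ratio F G) n = ratio (iterLift d F G n).1 (iterLift d F G n).2 := by
  induction n with
  | zero => simp [iter, iterLift, ratio]
  | succ n ih =>
    rw [iter, Function.iterate_succ_apply', ← iter, ih,
      comp_ratio hd (Nat.one_le_pow _ _ hd) h (h.iterLift n)]
    rfl

end RatFunc

/-! ### Ultrametric seminorms, the Gauss norm, and ordRes from an arbitrary lift. -/

section Seminorm

variable {K : Type*} [NontriviallyNormedField K]

lemma A1.nonneg (x : A1 K) (f : K[X]) : 0 ≤ x f := apply_nonneg x.toMulRingSeminorm f

lemma A1.map_mul (x : A1 K) (f g : K[X]) : x (f * g) = x f * x g := x.map_mul' f g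

lemma A1.map_C (x : A1 K) (a : K) : x (C a) = ‖a‖ := x.map_C' a

lemma A1.map_zero (x : A1 K) : x (0 : K[X]) = 0 := x.map_zero'

lemma A1.map_one (x : A1 K) : x (1 : K[X]) = 1 := x.map_one'

lemma A1.map_neg (x : A1 K) (f : K[X]) : x (-f) = x f := x.neg' f

lemma A1.map_pow (x : A1 K) (f : K[X]) (n : ℕ) : x (f ^ n) = x f ^ n := by
  induction n with
  | zero => simp [x.map_one]
  | succ n ih => rw [pow_succ, x.map_mul, ih, pow_succ]

lemma A1.map_C_mul (x : A1 K) (a : K) (f : K[X]) : x (C a * f) = ‖a‖ * x f := by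
  rw [x.map_mul, x.map_C]

variable [IsUltrametricDist K]

/-- The n-th root of n + 1 tends to 1. Concretely, with c = (1 + s)m and n = 2k, Bernoulli gives (1
+ ks)² ≤ 2k + 1, which fails once ks² > 2. -/
lemma le_of_forall_pow_le_succ_mul_pow {c m : ℝ} (hm : 0 ≤ m)
    (h : ∀ n : ℕ, c ^ n ≤ (n + 1) * m ^ n) (h0 : m = 0 → c ≤ 0) : c ≤ m := by
  by_contra! hc
  rcases hm.eq_or_lt with h1 | h1
  · linarith [h0 h1.symm]
  set s := c / m - 1 with hs
  have hs0 : 0 < s := by rw [hs, sub_pos, one_lt_div h1]; exact hc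
  obtain ⟨k, hk⟩ := exists_nat_gt (2 / s ^ 2)
  have hk' : 2 < k * s ^ 2 := by rwa [div_lt_iff₀ (by positivity)] at hk
  have h2 := h (2 * k)
  have h3 : (1 + k * s) ^ 2 ≤ 2 * k + 1 := by
    calc (1 + k * s) ^ 2 ≤ ((1 + s) ^ k) ^ 2 :=
          pow_le_pow_left₀ (by positivity) (one_add_mul_le_pow (by linarith) k) 2
      _ = c ^ (2 * k) / m ^ (2 * k) := by
          rw [← pow_mul, mul_comm k 2, ← div_pow, hs]; congr 1; ring
      _ ≤ 2 * k + 1 := by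
          rw [div_le_iff₀ (by positivity)]
          push_cast at h2
          exact h2
  have hk0 : (0 : ℝ) < k := by
    by_contra! hk0
    nlinarith [sq_nonneg s]
  nlinarith [mul_pos hk0 hs0, mul_lt_mul_of_pos_left hk' hk0]

/-- Only the triangle inequality is built into `A1`. Expand the n-th power of f + g: binomial
coefficients have norm at most 1, so there are n + 1 terms of size at most the n-th power of the
maximum. -/
lemma A1.add_le_max (x : A1 K) (f g : K[X]) : x (f + g) ≤ max (x f) (x g) := by
  have hm : 0 ≤ max (x f) (x g) := le_max_of_le_left (x.nonneg f)
  refine le_of_forall_pow_le_succ_mul_pow hm (fun n => ?_) (fun h0 => ?_)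
  · rw [← x.map_pow, add_pow]
    have hsum : ∀ (s : Finset ℕ) (u : ℕ → K[X]), x (∑ i ∈ s, u i) ≤ ∑ i ∈ s, x (u i) := by
      intro s u
      exact Finset.le_sum_of_subadditive x.toFun x.map_zero.le x.add_le' s u
    refine (hsum _ _).trans ((Finset.sum_le_card_nsmul _ _ (max (x f) (x g) ^ n) ?_).trans ?_)
    · intro i hi
      have hi : i ≤ n := Nat.lt_succ_iff.mp (Finset.mem_range.mp hi)
      have hn : x ((n.choose i : ℕ) : K[X]) ≤ 1 := by
        rw [← C_eq_natCast, x.map_C]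
        exact IsUltrametricDist.norm_natCast_le_one K _
      rw [x.map_mul, x.map_mul, x.map_pow, x.map_pow]
      calc x f ^ i * x g ^ (n - i) * x ((n.choose i : ℕ) : K[X])
          ≤ max (x f) (x g) ^ i * max (x f) (x g) ^ (n - i) * 1 := by
            refine mul_le_mul (mul_le_mul ?_ ?_ (pow_nonneg (x.nonneg _) _) (by positivity)) hn
              (x.nonneg _) (by positivity)
            · exact pow_le_pow_left₀ (x.nonneg _) (le_max_left _ _) _
            · exact pow_le_pow_left₀ (x.nonneg _) (le_max_right _ _) _
        _ = _ := by rw [mul_one, ← pow_add, Nat.add_sub_cancel' hi]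
    · simp
  · have h1 : x f ≤ 0 := h0 ▸ le_max_left _ _
    have h2 : x g ≤ 0 := h0 ▸ le_max_right _ _
    have := x.add_le' f g
    exact this.trans (by linarith)

lemma A1.sum_le (x : A1 K) {ι : Type*} (s : Finset ι) (u : ι → K[X]) {c : ℝ} (hc : 0 ≤ c)
    (h : ∀ i ∈ s, x (u i) ≤ c) : x (∑ i ∈ s, u i) ≤ c := by
  classical
  induction s using Finset.induction_on with
  | empty => rw [Finset.sum_empty, x.map_zero]; exact hc
  | insert i s hi ih =>
    rw [Finset.sum_insert hi]
    exact (x.add_le_max _ _).trans (max_le (h i (Finset.mem_insert_self _ _))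
      (ih fun j hj => h j (Finset.mem_insert_of_mem hj)))

lemma gauss_apply (f : K[X]) :
    (gaussA1 : A1 K) f = f.gaussNorm (NormedField.toAbsoluteValue K) 1 := by
  change (taylor 0 f).gaussNorm _ 1 = _
  rw [taylor_zero]

lemma norm_coeff_le_gauss (f : K[X]) (i : ℕ) : ‖f.coeff i‖ ≤ (gaussA1 : A1 K) f := by
  have := le_gaussNorm (NormedField.toAbsoluteValue K) f (zero_le_one (α := ℝ)) i
  rw [one_pow, mul_one] at this
  rw [gauss_apply]
  exact this

lemma exists_gauss_eq (f : K[X]) : ∃ i, (gaussA1 : A1 K) f = ‖f.coeff i‖ := by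
  obtain ⟨i, hi⟩ := exists_eq_gaussNorm (NormedField.toAbsoluteValue K) 1 f
  rw [one_pow, mul_one] at hi
  exact ⟨i, by rw [gauss_apply, hi]; rfl⟩

lemma gauss_le_iff {f : K[X]} {c : ℝ} : (gaussA1 : A1 K) f ≤ c ↔ ∀ i, ‖f.coeff i‖ ≤ c := by
  refine ⟨fun h i => (norm_coeff_le_gauss f i).trans h, fun h => ?_⟩
  obtain ⟨i, hi⟩ := exists_gauss_eq f
  rw [hi]
  exact h i

lemma gauss_pos {f : K[X]} (hf : f ≠ 0) : 0 < (gaussA1 : A1 K) f := by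
  refine lt_of_lt_of_le ?_ (norm_coeff_le_gauss f f.natDegree)
  simpa using hf

lemma gauss_linear (a b : K) : (gaussA1 : A1 K) (C a * X + C b) = max ‖a‖ ‖b‖ := by
  apply le_antisymm
  · rw [gauss_le_iff]
    intro i
    match i with
    | 0 => simp
    | 1 => simp [coeff_C]
    | i + 2 => simp
  · refine max_le ?_ ?_
    · have h : (C a * X + C b).coeff 1 = a := by simp [coeff_C]
      have h' := norm_coeff_le_gauss (C a * X + C b) 1
      rwa [h] at h'
    · have h : (C a * X + C b).coeff 0 = b := by simp
      have h' := norm_coeff_le_gauss (C a * X + C b) 0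
      rwa [h] at h'

lemma A1.heval_le (x : A1 K) (d : ℕ) (f p q : K[X]) :
    x (heval d f p q) ≤ (gaussA1 : A1 K) f * max (x p) (x q) ^ d := by
  have hm : 0 ≤ max (x p) (x q) := le_max_of_le_left (x.nonneg p)
  have hg := (gaussA1 : A1 K).nonneg f
  rw [heval_eq_sum]
  refine x.sum_le _ _ (by positivity) fun i hi => ?_
  have hi : i ≤ d := Nat.lt_succ_iff.mp (Finset.mem_range.mp hi)
  rw [algebraMap_eq, x.map_C_mul, x.map_mul, x.map_pow, x.map_pow]
  refine mul_le_mul (norm_coeff_le_gauss f i) ?_ ?_ hg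
  · calc _ ≤ max (x p) (x q) ^ i * max (x p) (x q) ^ (d - i) :=
          mul_le_mul (pow_le_pow_left₀ (x.nonneg _) (le_max_left _ _) _)
            (pow_le_pow_left₀ (x.nonneg _) (le_max_right _ _) _) (pow_nonneg (x.nonneg _) _)
            (by positivity)
      _ = _ := by rw [← pow_add, Nat.add_sub_cancel' hi]
  · exact mul_nonneg (pow_nonneg (x.nonneg _) _) (pow_nonneg (x.nonneg _) _)

lemma A1.combination_le (x : A1 K) {f g a b : K[X]} {s t : ℝ} (ha : x a ≤ s) (hb : x b ≤ s)
    (hf : x f ≤ t) (hg : x g ≤ t) : x (a * f + b * g) ≤ s * t := by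
  refine (x.add_le_max _ _).trans (max_le ?_ ?_) <;> rw [x.map_mul]
  · exact mul_le_mul ha hf (x.nonneg _) ((x.nonneg _).trans ha)
  · exact mul_le_mul hb hg (x.nonneg _) ((x.nonneg _).trans hb)

/-- The larger of the Gauss norms of `F` and `G`. -/
def pairNorm (F G : K[X]) : ℝ := max ((gaussA1 : A1 K) F) ((gaussA1 : A1 K) G)

lemma pairNorm_nonneg (F G : K[X]) : 0 ≤ pairNorm F G := le_max_of_le_left (A1.nonneg _ _)

lemma pairNorm_pos {F G : K[X]} (hG : G ≠ 0) : 0 < pairNorm F G := lt_max_of_lt_right (gauss_pos hG)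

lemma pairNorm_C_mul (c : K) (F G : K[X]) : pairNorm (C c * F) (C c * G) = ‖c‖ * pairNorm F G := by
  rw [pairNorm, A1.map_C_mul, A1.map_C_mul, pairNorm, mul_max_of_nonneg _ _ (norm_nonneg c)]

lemma IsNormalizedLift.pairNorm_eq_one {φ : RatFunc K} {F G : K[X]} (h : IsNormalizedLift φ F G) :
    pairNorm F G = 1 := by
  apply le_antisymm
  · exact max_le (gauss_le_iff.mpr h.integral_left) (gauss_le_iff.mpr h.integral_right)
  · obtain ⟨i, hi | hi⟩ := h.unit
    · exact le_max_of_le_left (hi ▸ norm_coeff_le_gauss F i)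
    · exact le_max_of_le_right (hi ▸ norm_coeff_le_gauss G i)

/-- Scaling a lift by c multiplies the resultant by c^(2d) and the norm of the pair by |c|, so the
right side is the same for every lift and is -log|Res| for a normalized one. -/
lemma ordRes_ratio [IsAlgClosed K] {q : ℝ} {d : ℕ} (hd : 1 ≤ d) {F G : K[X]}
    (h : NonDegenerate d F G) :
    ordRes q (ratio F G) = -Real.logb q ‖resultant F G d d‖ + 2 * d * Real.logb q (pairNorm F G) := by
  set φ := ratio F G with hφ
  have hdeg : deg φ = d := h.deg_ratio hd
  obtain ⟨F₀, G₀, hl, e⟩ : ∃ F₀ G₀, IsNormalizedLift φ F₀ G₀ ∧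
      ordRes q φ = -Real.logb q ‖resultant F₀ G₀ (deg φ) (deg φ)‖ :=
    ⟨_, _, (exists_isNormalizedLift φ).choose_spec.choose_spec, rfl⟩
  have hnd := nonDegenerate_of_isNormalizedLift hl
  rw [hdeg] at hnd
  obtain ⟨c, hc, rfl, rfl⟩ := h.exists_eq_C_mul hd hnd (by rw [← hφ]; exact hl.eq_div)
  have hn := hl.pairNorm_eq_one
  rw [pairNorm_C_mul] at hn
  rw [e, hdeg, resultant_C_mul_left, resultant_C_mul_right]
  have hM := pairNorm_pos (F := F) (h.right_ne_zero hd)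
  have hc' : ‖c‖ = (pairNorm F G)⁻¹ := eq_inv_of_mul_eq_one_left hn
  have hR : ‖resultant F G d d‖ ≠ 0 := by simpa using h.resultant_ne_zero
  rw [norm_mul, norm_mul, norm_pow, hc', ← mul_assoc, ← pow_add,
    Real.logb_mul (by positivity) hR, Real.logb_pow, Real.logb_inv]
  push_cast
  ring

end Seminorm

/-! ### The lower bound for a lift and its iterates. -/

section ResultantBound

variable {K : Type*} [NontriviallyNormedField K] [IsUltrametricDist K]

variable (K) in
/-- The valuation ring of `K`. -/
def integers : Subring K where
  carrier := {a | ‖a‖ ≤ 1}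
  mul_mem' {a b} ha hb := by
    simp only [Set.mem_ofPred_eq, norm_mul] at *
    exact mul_le_one₀ ha (norm_nonneg _) hb
  one_mem' := by simp
  add_mem' {a b} ha hb := (IsUltrametricDist.norm_add_le_max a b).trans (max_le ha hb)
  zero_mem' := by simp
  neg_mem' {a} ha := by simpa using ha

/-- The Bézout identity for the resultant holds over any commutative ring; applied over the
valuation ring it yields integral cofactors. -/
lemma exists_integral_bezout {d : ℕ} (hd : 1 ≤ d) {F G : K[X]} (hF : F.natDegree ≤ d)
    (hG : G.natDegree ≤ d) (hFG : pairNorm F G ≤ 1) :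
    ∃ a b : K[X], a.natDegree ≤ d - 1 ∧ b.natDegree ≤ d - 1 ∧ (gaussA1 : A1 K) a ≤ 1 ∧
      (gaussA1 : A1 K) b ≤ 1 ∧ a * F + b * G = C (resultant F G d d) := by
  have lift : ∀ f : K[X], (gaussA1 : A1 K) f ≤ 1 → ∃ f' : (integers K)[X],
      f'.map (integers K).subtype = f ∧ f'.natDegree = f.natDegree := by
    intro f hf
    have hf' : (↑f.coeffs : Set K) ⊆ integers K := by
      intro c hc
      obtain ⟨n, -, rfl⟩ := mem_coeffs_iff.mp hc
      exact gauss_le_iff.mp hf n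
    exact ⟨f.toSubring _ hf', map_toSubring _ _ _, natDegree_toSubring _ _ _⟩
  obtain ⟨F', rfl, hF'⟩ := lift F ((le_max_left _ _).trans hFG)
  obtain ⟨G', rfl, hG'⟩ := lift G ((le_max_right _ _).trans hFG)
  obtain ⟨a, b, ha, hb, hab⟩ := exists_mul_add_mul_eq_C_resultant (m := d) (n := d) F' G'
    (hF' ▸ hF) (hG' ▸ hG) (Or.inl (by omega))
  have hdeg : ∀ f : (integers K)[X], f.degree < d → (f.map (integers K).subtype).natDegree ≤ d - 1 := by
    intro f hf
    refine natDegree_map_le.trans ?_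
    by_cases h0 : f = 0
    · simp [h0]
    · have := (natDegree_lt_iff_degree_lt h0).mpr hf
      omega
  have hint : ∀ f : (integers K)[X], (gaussA1 : A1 K) (f.map (integers K).subtype) ≤ 1 := by
    intro f
    rw [gauss_le_iff]
    intro i
    rw [coeff_map]
    exact (f.coeff i).2
  refine ⟨a.map (integers K).subtype, b.map (integers K).subtype, hdeg a ha, hdeg b hb, hint a,
    hint b, ?_⟩
  rw [resultant_map_map, ← Polynomial.map_mul, ← Polynomial.map_mul, ← Polynomial.map_add,
    mul_comm a, mul_comm b, hab, Polynomial.map_C]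

/-- Homogenized in degree 2d - 1, the Bézout identity reads aF + bG = Res · Y^(2d-1); the cofactors
have degree d - 1 and integral coefficients. -/
lemma resultant_mul_gauss_right_le {d : ℕ} (hd : 1 ≤ d) {F G : K[X]} (hF : F.natDegree ≤ d)
    (hG : G.natDegree ≤ d) (hFG : pairNorm F G ≤ 1) (p q : K[X]) :
    ‖resultant F G d d‖ * (gaussA1 : A1 K) q ^ (d - 1 + d) ≤
      pairNorm p q ^ (d - 1) * pairNorm (heval d F p q) (heval d G p q) := by
  obtain ⟨a, b, ha, hb, ha1, hb1, hab⟩ := exists_integral_bezout hd hF hG hFG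
  have h := heval_C (d - 1 + d) (resultant F G d d) p q
  rw [← hab, heval_add, heval_mul ha hF, heval_mul hb hG, algebraMap_eq] at h
  rw [← A1.map_pow, ← A1.map_C_mul, ← h]
  refine A1.combination_le _ ?_ ?_ (le_max_left _ _) (le_max_right _ _)
  · exact (A1.heval_le _ _ _ _ _).trans
      (mul_le_of_le_one_left (pow_nonneg (pairNorm_nonneg _ _) _) ha1)
  · exact (A1.heval_le _ _ _ _ _).trans
      (mul_le_of_le_one_left (pow_nonneg (pairNorm_nonneg _ _) _) hb1)

lemma resultant_mul_pow_le [IsAlgClosed K] {d : ℕ} (hd : 1 ≤ d) {F G : K[X]} (hF : F.natDegree ≤ d)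
    (hG : G.natDegree ≤ d) (hFG : pairNorm F G ≤ 1) (p q : K[X]) :
    ‖resultant F G d d‖ * pairNorm p q ^ d ≤ pairNorm (heval d F p q) (heval d G p q) := by
  set M := pairNorm p q with hM
  set V := pairNorm (heval d F p q) (heval d G p q) with hV
  have hM0 : 0 ≤ M := pairNorm_nonneg _ _
  have hV0 : 0 ≤ V := pairNorm_nonneg _ _
  have h1 := resultant_mul_gauss_right_le hd hF hG hFG p q
  -- Exchanging the variables gives the same bound for X^(2d-1). Since det w = -1, the absolute
  -- value of the resultant does not change. Whichever of p, q has the larger norm, M^(d-1) then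
  -- cancels.
  let w : Matrix (Fin 2) (Fin 2) K := !![0, 1; 1, 0]
  have hw : ∀ f : K[X], (gaussA1 : A1 K) (subst d w f) ≤ (gaussA1 : A1 K) f := by
    intro f
    refine (A1.heval_le _ _ _ _ _).trans ?_
    rw [gauss_linear, gauss_linear]
    simp [w]
  have hw' : ∀ f : K[X], heval d (subst d w f) q p = heval d f p q := by
    intro f
    rw [heval_subst]
    simp [w]
  have h2 := resultant_mul_gauss_right_le hd (natDegree_subst_le d w F) (natDegree_subst_le d w G)
    ((max_le_max (hw F) (hw G)).trans hFG) q p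
  rw [hw', hw', resultant_subst w hF hG, norm_mul, norm_pow, Matrix.det_fin_two] at h2
  have hsw : pairNorm q p = M := max_comm _ _
  simp only [w, Matrix.of_apply, Matrix.cons_val', Matrix.cons_val_zero, Matrix.cons_val_one,
    mul_zero, mul_one, zero_sub, norm_neg, norm_one, one_pow, one_mul, hsw,
    Matrix.cons_val_fin_one] at h2
  have h3 : ‖resultant F G d d‖ * M ^ (d - 1 + d) ≤ M ^ (d - 1) * V := by
    rcases max_choice ((gaussA1 : A1 K) p) ((gaussA1 : A1 K) q) with h | h
    · rw [← h] at h2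
      exact h2
    · rw [← h] at h1
      exact h1
  rcases hM0.eq_or_lt with h0 | h0
  · rw [← h0, zero_pow (by omega), mul_zero]
    exact hV0
  · rw [pow_add, mul_left_comm] at h3
    exact le_of_mul_le_mul_left h3 (by positivity)

lemma pairNorm_iterLift_le {d : ℕ} {F G : K[X]} (hFG : pairNorm F G ≤ 1) (n : ℕ) :
    pairNorm (iterLift d F G n).1 (iterLift d F G n).2 ≤ 1 := by
  induction n with
  | zero =>
    have h : (iterLift d F G 0).1 = C 1 * X + C 0 := by simp [iterLift]
    rw [pairNorm, h, gauss_linear]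
    simp [iterLift, A1.map_one]
  | succ n ih =>
    refine max_le ?_ ?_
    · refine (A1.heval_le _ _ _ _ _).trans (mul_le_one₀ ((le_max_left _ _).trans hFG) ?_ ?_)
      · exact pow_nonneg (pairNorm_nonneg _ _) _
      · exact pow_le_one₀ (pairNorm_nonneg _ _) ih
    · refine (A1.heval_le _ _ _ _ _).trans (mul_le_one₀ ((le_max_right _ _).trans hFG) ?_ ?_)
      · exact pow_nonneg (pairNorm_nonneg _ _) _
      · exact pow_le_one₀ (pairNorm_nonneg _ _) ih

/-- One application gives v ↦ log|Res| + d·v as a lower bound for the logarithm. The factor d - 1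
clears the denominator of the geometric sum (d^n - 1)/(d - 1). -/
lemma logb_pairNorm_iterLift [IsAlgClosed K] {q : ℝ} (hq : 1 < q) {d : ℕ} (hd : 1 ≤ d) {F G : K[X]}
    (h : NonDegenerate d F G) (hFG : pairNorm F G ≤ 1) {p r : K[X]} (hpr : 0 < pairNorm p r)
    (n : ℕ) :
    0 < pairNorm (heval (d ^ n) (iterLift d F G n).1 p r) (heval (d ^ n) (iterLift d F G n).2 p r) ∧
    Real.logb q ‖resultant F G d d‖ * ((d : ℝ) ^ n - 1) +
        (d - 1) * (d : ℝ) ^ n * Real.logb q (pairNorm p r) ≤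
      (d - 1) * Real.logb q (pairNorm (heval (d ^ n) (iterLift d F G n).1 p r)
        (heval (d ^ n) (iterLift d F G n).2 p r)) := by
  induction n with
  | zero =>
    have h1 : heval (d ^ 0) (iterLift d F G 0).1 p r = p := by
      have := heval_linear (1 : K) 0 p r
      simpa [iterLift] using this
    have h2 : heval (d ^ 0) (iterLift d F G 0).2 p r = r := by
      have := heval_linear (0 : K) 1 p r
      simpa [iterLift] using this
    rw [h1, h2]
    refine ⟨hpr, ?_⟩
    simp
  | succ n ih =>
    have hl := h.iterLift n
    have h1 : ∀ f : K[X], heval (d ^ (n + 1))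
        (heval d f (iterLift d F G n).1 (iterLift d F G n).2) p r =
        heval d f (heval (d ^ n) (iterLift d F G n).1 p r)
          (heval (d ^ n) (iterLift d F G n).2 p r) := by
      intro f
      rw [pow_succ', heval_heval f hl.left hl.right]
    have hR : 0 < ‖resultant F G d d‖ := by simpa using h.resultant_ne_zero
    have hb := resultant_mul_pow_le hd h.left h.right hFG
      (heval (d ^ n) (iterLift d F G n).1 p r) (heval (d ^ n) (iterLift d F G n).2 p r)
    rw [iterLift, h1, h1]
    obtain ⟨ih0, ih1⟩ := ih
    set V := pairNorm (heval (d ^ n) (iterLift d F G n).1 p r)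
          (heval (d ^ n) (iterLift d F G n).2 p r)
    have hpos : 0 < ‖resultant F G d d‖ * V ^ d := by positivity
    refine ⟨hpos.trans_le hb, ?_⟩
    have h3 := Real.logb_le_logb_of_le hq hpos hb
    rw [Real.logb_mul hR.ne' (by positivity), Real.logb_pow] at h3
    have hd' : (0 : ℝ) ≤ d - 1 := by
      have : (1 : ℝ) ≤ d := by exact_mod_cast hd
      linarith
    have h4 := mul_le_mul_of_nonneg_left h3 hd'
    have h5 := mul_le_mul_of_nonneg_left ih1 (Nat.cast_nonneg d)
    refine le_trans ?_ h4
    rw [pow_succ]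
    nlinarith [h5]

end ResultantBound

/-! ### Norms of matrices and of conjugated lifts. -/

section MatrixNorm

variable {K : Type*} [NontriviallyNormedField K]

/-- The largest absolute value of an entry. -/
def entryNorm (γ : Matrix (Fin 2) (Fin 2) K) : ℝ :=
  max (max ‖γ 0 0‖ ‖γ 0 1‖) (max ‖γ 1 0‖ ‖γ 1 1‖)

lemma entryNorm_le_iff {γ : Matrix (Fin 2) (Fin 2) K} {c : ℝ} :
    entryNorm γ ≤ c ↔ (‖γ 0 0‖ ≤ c ∧ ‖γ 0 1‖ ≤ c) ∧ ‖γ 1 0‖ ≤ c ∧ ‖γ 1 1‖ ≤ c := by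
  simp only [entryNorm, max_le_iff]

lemma norm_entry_le (γ : Matrix (Fin 2) (Fin 2) K) (i j : Fin 2) : ‖γ i j‖ ≤ entryNorm γ := by
  have h := entryNorm_le_iff.mp (le_refl (entryNorm γ))
  fin_cases i <;> fin_cases j
  exacts [h.1.1, h.1.2, h.2.1, h.2.2]

lemma entryNorm_pos (γ : GL (Fin 2) K) : 0 < entryNorm (γ : Matrix (Fin 2) (Fin 2) K) := by
  by_contra! h
  obtain ⟨⟨h1, h2⟩, -, -⟩ := entryNorm_le_iff.mp h
  rw [norm_le_zero_iff] at h1 h2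
  apply det_ne_zero γ
  rw [Matrix.det_fin_two, h1, h2, zero_mul, zero_mul, sub_zero]

/-- The adjugate of a 2×2 matrix has the same entries up to order and sign. -/
lemma entryNorm_inv (γ : GL (Fin 2) K) :
    ‖(γ : Matrix (Fin 2) (Fin 2) K).det‖ * entryNorm (γ⁻¹ : GL (Fin 2) K).1 = entryNorm γ.1 := by
  have h : (γ⁻¹ : GL (Fin 2) K).1 = (γ.1.det)⁻¹ • γ.1.adjugate := by
    rw [Matrix.coe_units_inv, Matrix.inv_def, Ring.inverse_eq_inv']
  have hd : ‖γ.1.det‖ ≠ 0 := by simpa using det_ne_zero γ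
  rw [h, Matrix.adjugate_fin_two]
  simp only [entryNorm, Matrix.smul_apply, smul_eq_mul, norm_mul, norm_inv, Matrix.of_apply,
    Matrix.cons_val', Matrix.cons_val_zero, Matrix.cons_val_one, Matrix.cons_val_fin_one, norm_neg]
  have hp : 0 ≤ ‖γ.1.det‖⁻¹ := by positivity
  rw [← mul_max_of_nonneg _ _ hp, ← mul_max_of_nonneg _ _ hp, ← mul_max_of_nonneg _ _ hp,
    mul_inv_cancel_left₀ hd, max_comm ‖γ.1 1 1‖, max_comm ‖γ.1 1 0‖, max_max_max_comm,
    max_comm ‖γ.1 0 1‖, max_comm ‖γ.1 1 1‖]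

variable [IsUltrametricDist K]

lemma pairNorm_rows (γ : Matrix (Fin 2) (Fin 2) K) :
    pairNorm (C (γ 0 0) * X + C (γ 0 1)) (C (γ 1 0) * X + C (γ 1 1)) = entryNorm γ := by
  rw [pairNorm, gauss_linear, gauss_linear, entryNorm]

lemma gauss_combination_le {a b : K} {s : ℝ} (ha : ‖a‖ ≤ s) (hb : ‖b‖ ≤ s) (f g : K[X]) :
    (gaussA1 : A1 K) (C a * f + C b * g) ≤ s * pairNorm f g :=
  A1.combination_le _ (by rwa [A1.map_C]) (by rwa [A1.map_C]) (le_max_left _ _) (le_max_right _ _)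

lemma pairNorm_conj_le (d : ℕ) (γ : GL (Fin 2) K) (F G : K[X]) :
    pairNorm (conjLeft d γ F G) (conjRight d γ F G) ≤
      entryNorm (γ⁻¹ : GL (Fin 2) K).1 * (pairNorm F G * entryNorm γ.1 ^ d) := by
  have h : pairNorm (subst d γ.1 F) (subst d γ.1 G) ≤ pairNorm F G * entryNorm γ.1 ^ d := by
    have key : ∀ f : K[X], (gaussA1 : A1 K) (subst d γ.1 f) ≤
        (gaussA1 : A1 K) f * entryNorm γ.1 ^ d := by
      intro f
      rw [← pairNorm_rows]
      exact A1.heval_le _ _ _ _ _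
    have hp : 0 ≤ entryNorm γ.1 ^ d := pow_nonneg (entryNorm_pos γ).le d
    exact max_le ((key F).trans (mul_le_mul_of_nonneg_right (le_max_left _ _) hp))
      ((key G).trans (mul_le_mul_of_nonneg_right (le_max_right _ _) hp))
  have h' := mul_le_mul_of_nonneg_left h (entryNorm_pos γ⁻¹).le
  exact max_le ((gauss_combination_le (norm_entry_le _ _ _) (norm_entry_le _ _ _) _ _).trans h')
    ((gauss_combination_le (norm_entry_le _ _ _) (norm_entry_le _ _ _) _ _).trans h')

/-- Applying γ to the conjugated lift undoes the outer γ⁻¹, at the cost of one factor of the norm of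
γ. -/
lemma pairNorm_subst_le (d : ℕ) (γ : GL (Fin 2) K) (F G : K[X]) :
    pairNorm (subst d γ.1 F) (subst d γ.1 G) ≤
      entryNorm γ.1 * pairNorm (conjLeft d γ F G) (conjRight d γ F G) := by
  have h : γ.1 * (γ⁻¹ : GL (Fin 2) K).1 = 1 := by rw [← Units.val_mul, mul_inv_cancel, Units.val_one]
  have e : ∀ i j, γ.1 i 0 * (γ⁻¹ : GL (Fin 2) K).1 0 j + γ.1 i 1 * (γ⁻¹ : GL (Fin 2) K).1 1 j =
      (1 : Matrix (Fin 2) (Fin 2) K) i j := by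
    intro i j
    rw [← h, Matrix.mul_apply, Fin.sum_univ_two]
  have key : ∀ i, C (γ.1 i 0) * conjLeft d γ F G + C (γ.1 i 1) * conjRight d γ F G =
      C ((1 : Matrix (Fin 2) (Fin 2) K) i 0) * subst d γ.1 F +
        C ((1 : Matrix (Fin 2) (Fin 2) K) i 1) * subst d γ.1 G := by
    intro i
    rw [← e, ← e, conjLeft, conjRight]
    simp only [C_add, C_mul]
    ring
  have h0 := key 0
  have h1 := key 1
  simp only [Matrix.one_apply_eq, ne_eq, zero_ne_one, not_false_eq_true, Matrix.one_apply_ne,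
    C_0, C_1, one_mul, zero_mul, add_zero, zero_add, one_ne_zero] at h0 h1
  refine max_le ?_ ?_
  · rw [← h0]
    exact gauss_combination_le (norm_entry_le _ _ _) (norm_entry_le _ _ _) _ _
  · rw [← h1]
    exact gauss_combination_le (norm_entry_le _ _ _) (norm_entry_le _ _ _) _ _

end MatrixNorm

/-! ### The function ordRes along conjugation. -/

section OrdRes

variable {K : Type*} [NontriviallyNormedField K] [IsUltrametricDist K] [IsAlgClosed K]

lemma ordRes_conj {q : ℝ} {d : ℕ} (hd : 1 ≤ d) {F G : K[X]} (h : NonDegenerate d F G)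
    (γ : GL (Fin 2) K) :
    ordRes q (conj (ratio F G) γ) = -Real.logb q ‖resultant F G d d‖ -
      d * (d - 1) * Real.logb q ‖γ.1.det‖ +
      2 * d * Real.logb q (pairNorm (conjLeft d γ F G) (conjRight d γ F G)) := by
  rw [conj_ratio hd h, ordRes_ratio hd (h.conj γ)]
  have hr := congrArg (fun a => Real.logb q ‖a‖) (resultant_conj h.left h.right γ)
  have h1 : ‖resultant (conjLeft d γ F G) (conjRight d γ F G) d d‖ ≠ 0 := by
    simpa using (h.conj γ).resultant_ne_zero
  have h2 : ‖resultant F G d d‖ ≠ 0 := by simpa using h.resultant_ne_zero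
  have h3 : ‖γ.1.det‖ ≠ 0 := by simpa using det_ne_zero γ
  simp only [norm_mul, norm_pow] at hr
  rw [Real.logb_mul h1 (pow_ne_zero _ h3), Real.logb_mul (pow_ne_zero _ h3) h2, Real.logb_pow,
    Real.logb_pow] at hr
  push_cast at hr
  linarith

/-- With A, B the logarithmic norms of γ and γ⁻¹, log|det γ| = A - B, and 2d(B + dA) - d(d-1)(A - B)
= d(d+1)(A + B). The quantity A + B is invariant under scaling of γ. -/
lemma ordRes_conj_le {q : ℝ} (hq : 1 < q) {d : ℕ} (hd : 1 ≤ d) {F G : K[X]}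
    (h : NonDegenerate d F G) (γ : GL (Fin 2) K) :
    ordRes q (conj (ratio F G) γ) ≤ ordRes q (ratio F G) +
      d * (d + 1) * Real.logb q (entryNorm γ.1 * entryNorm (γ⁻¹ : GL (Fin 2) K).1) := by
  have hA := entryNorm_pos γ
  have hB := entryNorm_pos γ⁻¹
  have hM := pairNorm_pos (F := F) (h.right_ne_zero hd)
  have hM' := pairNorm_pos (F := conjLeft d γ F G) ((h.conj γ).right_ne_zero hd)
  have h3 : ‖γ.1.det‖ ≠ 0 := by simpa using det_ne_zero γ
  have h1 := Real.logb_le_logb_of_le hq hM' (pairNorm_conj_le d γ F G)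
  rw [Real.logb_mul hB.ne' (by positivity), Real.logb_mul hM.ne' (by positivity),
    Real.logb_pow] at h1
  have h2 := congrArg (Real.logb q) (entryNorm_inv γ)
  rw [Real.logb_mul h3 hB.ne'] at h2
  rw [ordRes_conj hd h, ordRes_ratio hd h, Real.logb_mul hA.ne' hB.ne', ← h2]
  rw [← h2] at h1
  have h4 := mul_le_mul_of_nonneg_left h1 (by positivity : (0 : ℝ) ≤ 2 * d)
  linarith

lemma ordRes_conj_le_ordRes_conj {q : ℝ} (hq : 1 < q) {d : ℕ} (hd : 1 ≤ d) {F G : K[X]}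
    (h : NonDegenerate d F G) (γ γ' : GL (Fin 2) K) :
    ordRes q (conj (ratio F G) γ') ≤ ordRes q (conj (ratio F G) γ) +
      d * (d + 1) * Real.logb q
        (entryNorm (γ⁻¹ * γ' : GL (Fin 2) K).1 * entryNorm (γ'⁻¹ * γ : GL (Fin 2) K).1) := by
  have h1 := ordRes_conj_le hq hd (h.conj γ) (γ⁻¹ * γ')
  rwa [← conj_ratio hd h, conj_conj hd h, mul_inv_cancel_left, mul_inv_rev, inv_inv] at h1

/-- The central estimate. The rows of γ enter the iterated lift with exponent N, and removing the
outer γ⁻¹ costs one factor of the norm of γ, leaving N - 1. Multiplication by 2N matches the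
coefficient N(N-1) of log|det γ|. -/
lemma le_ordRes_conj_iter {q : ℝ} (hq : 1 < q) {d : ℕ} (hd : 2 ≤ d) {F G : K[X]}
    (h : NonDegenerate d F G) (hFG : pairNorm F G = 1) (n : ℕ) (γ : GL (Fin 2) K) :
    ordRes q (ratio (iterLift d F G n).1 (iterLift d F G n).2) +
      d ^ n * (d ^ n - 1) * (2 * Real.logb q (entryNorm γ.1) - Real.logb q ‖γ.1.det‖ -
        2 / (d - 1) * ordRes q (ratio F G)) ≤
      ordRes q (conj (ratio (iterLift d F G n).1 (iterLift d F G n).2) γ) := by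
  have hd1 : 1 ≤ d := by omega
  have hN : 1 ≤ d ^ n := Nat.one_le_pow _ _ hd1
  have hl := h.iterLift n
  have hd' : (0 : ℝ) < d - 1 := by
    have : (2 : ℝ) ≤ d := by exact_mod_cast hd
    linarith
  have hpos := entryNorm_pos γ
  rw [ordRes_conj hN hl, ordRes_ratio hN hl, ordRes_ratio hd1 h, hFG, Real.logb_one]
  obtain ⟨hV0, hV⟩ := logb_pairNorm_iterLift hq hd1 h hFG.le
    (by rw [pairNorm_rows]; exact hpos :
      0 < pairNorm (C (γ.1 0 0) * X + C (γ.1 0 1)) (C (γ.1 1 0) * X + C (γ.1 1 1))) n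
  rw [pairNorm_rows] at hV
  change 0 < pairNorm (subst (d ^ n) γ.1 (iterLift d F G n).1)
    (subst (d ^ n) γ.1 (iterLift d F G n).2) at hV0
  change _ ≤ _ * Real.logb q (pairNorm (subst (d ^ n) γ.1 (iterLift d F G n).1)
    (subst (d ^ n) γ.1 (iterLift d F G n).2)) at hV
  have h1 := Real.logb_le_logb_of_le hq hV0 (pairNorm_subst_le (d ^ n) γ _ _)
  have hM' := pairNorm_pos (F := conjLeft (d ^ n) γ (iterLift d F G n).1 (iterLift d F G n).2)
    ((hl.conj γ).right_ne_zero hN)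
  rw [Real.logb_mul hpos.ne' hM'.ne'] at h1
  have h2 : Real.logb q (pairNorm (iterLift d F G n).1 (iterLift d F G n).2) ≤ 0 :=
    Real.logb_nonpos hq (pairNorm_nonneg _ _) (pairNorm_iterLift_le hFG.le n)
  set Lm := Real.logb q (entryNorm γ.1)
  set Ld := Real.logb q ‖γ.1.det‖
  set LV := Real.logb q (pairNorm (subst (d ^ n) γ.1 (iterLift d F G n).1)
    (subst (d ^ n) γ.1 (iterLift d F G n).2))
  set LM := Real.logb q (pairNorm (conjLeft (d ^ n) γ (iterLift d F G n).1 (iterLift d F G n).2)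
    (conjRight (d ^ n) γ (iterLift d F G n).1 (iterLift d F G n).2))
  set c := Real.logb q ‖resultant F G d d‖
  push_cast
  have hNr : (1 : ℝ) ≤ (d : ℝ) ^ n := by exact_mod_cast hN
  set N : ℝ := (d : ℝ) ^ n
  have h3 : c / (d - 1) * (N - 1) + N * Lm ≤ Lm + LM := by
    refine le_trans ?_ h1
    rw [← mul_le_mul_iff_right₀ hd']
    refine le_of_eq_of_le ?_ hV
    field_simp
  have h4 := mul_le_mul_of_nonneg_left h3 (by positivity : 0 ≤ 2 * N)
  have h5 := mul_nonpos_of_nonneg_of_nonpos (by positivity : 0 ≤ 2 * N) h2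
  have h6 : 2 / ((d : ℝ) - 1) * (-c + 2 * d * 0) = -2 * (c / (d - 1)) := by ring
  rw [h6]
  linarith

end OrdRes

/-! ### Values on linear forms, diameters and paths. -/

section Linear

variable {K : Type*} [NontriviallyNormedField K]

/-- The normalized value of the point `x` at the linear form `aX + bY`. -/
def lin (x : P1 K) (a b : K) : ℝ := val x 1 (C a * X + C b)

lemma lin_infty (a b : K) : lin (OnePoint.infty : P1 K) a b = ‖a‖ := by
  change ‖(C a * X + C b).coeff 1‖ = ‖a‖
  simp [coeff_C]

lemma lin_coe (x : A1 K) (a b : K) :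
    lin (x : P1 K) a b = x (C a * X + C b) / max 1 (x X) := by
  change x (C a * X + C b) / max 1 (x X) ^ 1 = _
  rw [pow_one]

lemma A1.max_pos (x : A1 K) : 0 < max 1 (x X) := lt_max_of_lt_left one_pos

lemma lin_nonneg (x : P1 K) (a b : K) : 0 ≤ lin x a b := by
  induction x using OnePoint.rec with
  | infty => rw [lin_infty]; exact norm_nonneg _
  | coe x => rw [lin_coe]; exact div_nonneg (x.nonneg _) x.max_pos.le

lemma lin_mul (x : P1 K) (c a b : K) : lin x (c * a) (c * b) = ‖c‖ * lin x a b := by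
  induction x using OnePoint.rec with
  | infty => rw [lin_infty, lin_infty, norm_mul]
  | coe x =>
    rw [lin_coe, lin_coe, mul_div_assoc', ← x.map_C_mul, mul_add, ← mul_assoc, ← C_mul, ← C_mul]

lemma lin_max_eq_one (x : P1 K) : max (lin x 1 0) (lin x 0 1) = 1 := by
  induction x using OnePoint.rec with
  | infty => simp [lin_infty]
  | coe x =>
    rw [lin_coe, lin_coe, max_div_div_right x.max_pos.le]
    simp only [C_1, C_0, one_mul, zero_mul, add_zero, zero_add, x.map_one]
    rw [max_comm, div_self x.max_pos.ne']

lemma diamG_coe (x : A1 K) : diamG (x : P1 K) =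
    if x X ≤ 1 then ⨅ a : K, x (X - C a) else ⨅ a : K, x (1 - C a * X) / x X := rfl

lemma lin_le_of_mem_path {x z : P1 K} (h : z ∈ path x) (a b : K) : lin x a b ≤ lin z a b :=
  h 1 _ natDegree_linear_le

lemma mem_path_self (x : P1 K) : x ∈ path x := fun _ _ _ => le_rfl

lemma exists_unit_multiple (a b : K) :
    ∃ c a' b' : K, a = c * a' ∧ b = c * b' ∧ max ‖a'‖ ‖b'‖ = 1 := by
  rcases le_total ‖a‖ ‖b‖ with h | h
  · by_cases hb : b = 0
    · refine ⟨0, 1, 0, ?_, ?_, by simp⟩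
      · rw [hb, norm_zero, norm_le_zero_iff] at h; simp [h]
      · simp [hb]
    · refine ⟨b, a / b, 1, by field_simp, by simp, ?_⟩
      rw [norm_one, norm_div]
      exact max_eq_right (div_le_one_of_le₀ h (norm_nonneg _))
  · by_cases ha : a = 0
    · refine ⟨0, 1, 0, by simp [ha], ?_, by simp⟩
      rw [ha, norm_zero, norm_le_zero_iff] at h; simp [h]
    · refine ⟨a, 1, b / a, by simp, by field_simp, ?_⟩
      rw [norm_one, norm_div]
      exact max_eq_left (div_le_one_of_le₀ h (norm_nonneg _))

variable [IsUltrametricDist K]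

lemma lin_add_le (x : P1 K) (a b a' b' : K) :
    lin x (a + a') (b + b') ≤ max (lin x a b) (lin x a' b') := by
  induction x using OnePoint.rec with
  | infty => simpa only [lin_infty] using IsUltrametricDist.norm_add_le_max a a'
  | coe x =>
    rw [lin_coe, lin_coe, lin_coe, max_div_div_right x.max_pos.le]
    refine div_le_div_of_nonneg_right ?_ x.max_pos.le
    have : C (a + a') * X + C (b + b') = (C a * X + C b) + (C a' * X + C b') := by
      simp only [C_add]; ring
    rw [this]
    exact x.add_le_max _ _

lemma A1.le_max_of_add (x : A1 K) (f g : K[X]) : x g ≤ max (x (f + g)) (x f) := by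
  have := x.add_le_max (f + g) (-f)
  rwa [add_neg_cancel_comm, x.map_neg] at this

lemma A1.one_le_linear (x : A1 K) (hx : x X ≤ 1) {a b : K} (ha : ‖a‖ < 1) (hb : ‖b‖ = 1) :
    1 ≤ x (C a * X + C b) := by
  have h := x.le_max_of_add (C a * X) (C b)
  rw [x.map_C, hb, x.map_C_mul] at h
  have : ‖a‖ * x X < 1 := lt_of_le_of_lt (mul_le_of_le_one_right (norm_nonneg _) hx) ha
  rcases le_max_iff.mp h with h | h
  · exact h
  · linarith

lemma A1.le_linear (x : A1 K) {a b : K} (h : ‖b‖ < ‖a‖ * x X) : ‖a‖ * x X ≤ x (C a * X + C b) := by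
  have h' := x.le_max_of_add (C b) (C a * X)
  rw [x.map_C, x.map_C_mul, add_comm] at h'
  rcases le_max_iff.mp h' with h' | h'
  · exact h'
  · linarith

lemma bddBelow_range_of_nonneg {ι : Type*} {f : ι → ℝ} (h : ∀ i, 0 ≤ f i) :
    BddBelow (Set.range f) := ⟨0, by rintro _ ⟨i, rfl⟩; exact h i⟩

/-- Together with `exists_lin_lt` this shows that the diameter is the infimum of `lin` over linear
forms with larger coefficient of norm 1, a description independent of the charts at 0 and ∞. -/
lemma diamG_le_lin (x : P1 K) {a b : K} (hab : max ‖a‖ ‖b‖ = 1) : diamG x ≤ lin x a b := by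
  induction x using OnePoint.rec with
  | infty => rw [lin_infty]; exact norm_nonneg _
  | coe x =>
    have ha1 : ‖a‖ ≤ 1 := hab ▸ le_max_left _ _
    have hb1 : ‖b‖ ≤ 1 := hab ▸ le_max_right _ _
    rw [lin_coe, diamG_coe]
    split_ifs with hx
    · have hinf : ∀ c : K, ⨅ a : K, x (X - C a) ≤ x (X - C c) :=
        ciInf_le (bddBelow_range_of_nonneg fun a => x.nonneg _)
      rw [max_eq_left hx, div_one]
      rcases ha1.eq_or_lt with ha | ha
      · have ha0 : a ≠ 0 := by rintro rfl; simp at ha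
        have e : C a * X + C b = C a * (X - C (-(b / a))) := by
          rw [mul_sub, ← C_mul, mul_neg, mul_div_cancel₀ _ ha0, C_neg, sub_neg_eq_add]
        rw [e, x.map_C_mul, ha, one_mul]
        exact hinf _
      · have hb : ‖b‖ = 1 := by
          rcases max_choice ‖a‖ ‖b‖ with h | h <;> rw [hab] at h
          · linarith
          · exact h.symm
        refine le_trans ?_ (x.one_le_linear hx ha hb)
        have := hinf 0
        rw [C_0, sub_zero] at this
        exact this.trans hx
    · push Not at hx
      have hx0 : 0 < x X := one_pos.trans hx
      have hinf : ∀ c : K, ⨅ a : K, x (1 - C a * X) / x X ≤ x (1 - C c * X) / x X :=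
        ciInf_le (bddBelow_range_of_nonneg fun a => div_nonneg (x.nonneg _) (x.nonneg _))
      rw [max_eq_right hx.le]
      rcases hb1.eq_or_lt with hb | hb
      · have hb0 : b ≠ 0 := by rintro rfl; simp at hb
        have e : C a * X + C b = C b * (1 - C (-(a / b)) * X) := by
          rw [mul_sub, ← mul_assoc, ← C_mul, mul_neg, mul_div_cancel₀ _ hb0, C_neg]
          ring
        rw [e, x.map_C_mul, hb, one_mul]
        exact hinf _
      · have ha : ‖a‖ = 1 := by
          rcases max_choice ‖a‖ ‖b‖ with h | h <;> rw [hab] at h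
          · exact h.symm
          · linarith
        have h1 := x.le_linear (a := a) (b := b) (by rw [ha, one_mul]; linarith)
        rw [ha, one_mul] at h1
        have h2 := hinf 0
        rw [C_0, zero_mul, sub_zero, x.map_one] at h2
        refine h2.trans (div_le_div_of_nonneg_right (hx.le.trans h1) hx0.le)

lemma exists_lin_lt (x : P1 K) {t : ℝ} (ht : diamG x < t) :
    ∃ a b : K, max ‖a‖ ‖b‖ = 1 ∧ lin x a b < t := by
  have hle := lin_max_eq_one x
  induction x using OnePoint.rec with
  | infty => exact ⟨0, 1, by simp, by rw [lin_infty, norm_zero]; exact ht⟩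
  | coe x =>
    rw [diamG_coe] at ht
    split_ifs at ht with hx
    · obtain ⟨a, ha⟩ := exists_lt_of_ciInf_lt ht
      by_cases ha1 : ‖a‖ ≤ 1
      · refine ⟨1, -a, by simpa using ha1, ?_⟩
        rw [lin_coe, max_eq_left hx, div_one, C_1, one_mul, C_neg, ← sub_eq_add_neg]
        exact ha
      · push Not at ha1
        -- A centre outside the unit disc gives |T - a| ≥ |a| > 1, so t > 1 and the form X already
        -- works.
        refine ⟨1, 0, by simp, lt_of_le_of_lt (hle ▸ le_max_left _ _) (lt_trans ?_ ha)⟩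
        have h := x.le_max_of_add X (-C a)
        rw [← sub_eq_add_neg, x.map_neg, x.map_C] at h
        rcases le_max_iff.mp h with h | h <;> linarith
    · push Not at hx
      have hx0 : 0 < x X := one_pos.trans hx
      obtain ⟨a, ha⟩ := exists_lt_of_ciInf_lt ht
      by_cases ha1 : ‖a‖ ≤ 1
      · refine ⟨-a, 1, by simpa using ha1, ?_⟩
        have e : C (-a) * X + C 1 = 1 - C a * X := by rw [C_neg, C_1]; ring
        rw [lin_coe, max_eq_right hx.le, e]
        exact ha
      · push Not at ha1
        refine ⟨0, 1, by simp, lt_of_le_of_lt (hle ▸ le_max_right _ _) (lt_trans ?_ ha)⟩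
        have h := x.le_linear (a := -a) (b := 1) (by rw [norm_one, norm_neg]; nlinarith)
        have e : C (-a) * X + C 1 = 1 - C a * X := by rw [C_neg, C_1]; ring
        rw [norm_neg, e] at h
        rw [lt_div_iff₀ hx0]
        nlinarith

lemma diamG_nonneg (x : P1 K) : 0 ≤ diamG x := by
  by_contra! h
  obtain ⟨a, b, -, hab⟩ := exists_lin_lt x h
  linarith [lin_nonneg x a b]

lemma diamG_le_one (x : P1 K) : diamG x ≤ 1 :=
  (diamG_le_lin x (a := 1) (b := 0) (by simp)).trans
    (lin_max_eq_one x ▸ le_max_left _ _)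

lemma diamG_of_mem_typeI {x : P1 K} (hx : x ∈ typeI) : diamG x = 0 := by
  refine le_antisymm ?_ (diamG_nonneg x)
  rcases hx with rfl | ⟨a, rfl⟩
  · exact le_rfl
  · have h0 : lin ((A1.classical a : A1 K) : P1 K) 1 (-a) = 0 := by
      rw [lin_coe]
      have : (A1.classical a : A1 K) (C 1 * X + C (-a)) = 0 := by
        change ‖(C 1 * X + C (-a)).eval a‖ = 0
        simp
      rw [this, zero_div]
    by_cases ha : ‖a‖ ≤ 1
    · rw [← h0]
      exact diamG_le_lin _ (by simpa using ha)
    · push Not at ha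
      have ha0 : a ≠ 0 := by rintro rfl; norm_num at ha
      have h1 := lin_mul ((A1.classical a : A1 K) : P1 K) a⁻¹ 1 (-a)
      rw [h0, mul_zero] at h1
      rw [← h1]
      refine diamG_le_lin _ ?_
      rw [mul_neg, inv_mul_cancel₀ ha0, norm_neg, norm_one, mul_one, norm_inv]
      exact max_eq_right (inv_le_one_of_one_le₀ ha.le)

/-! ### Paths -/

lemma le_of_forall_unit_lin {x : P1 K} {s : ℝ} (h : ∀ a b : K, max ‖a‖ ‖b‖ = 1 → s ≤ lin x a b) :
    s ≤ diamG x := by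
  by_contra! hs
  obtain ⟨a, b, hab, hlt⟩ := exists_lin_lt x hs
  linarith [h a b hab]

lemma diamG_le_of_mem_path {x z : P1 K} (h : z ∈ path x) : diamG x ≤ diamG z :=
  le_of_forall_unit_lin fun a b hab => (diamG_le_lin x hab).trans (lin_le_of_mem_path h a b)

/-- Cramer's rule: det · X and det · Y are integral combinations of the two forms, and X or Y has
normalized value 1. -/
lemma norm_det_le_lin (x : P1 K) {a b c e : K} (hab : max ‖a‖ ‖b‖ = 1) (hce : max ‖c‖ ‖e‖ = 1) :
    ‖a * e - b * c‖ ≤ max (lin x a b) (lin x c e) := by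
  have key : ∀ s t : K, ‖s‖ ≤ 1 → ‖t‖ ≤ 1 → lin x (s * a + t * c) (s * b + t * e) ≤
      max (lin x a b) (lin x c e) := by
    intro s t hs ht
    refine (lin_add_le x _ _ _ _).trans (max_le_max ?_ ?_) <;> rw [lin_mul]
    · exact mul_le_of_le_one_left (lin_nonneg _ _ _) hs
    · exact mul_le_of_le_one_left (lin_nonneg _ _ _) ht
  have ha : ‖a‖ ≤ 1 := hab ▸ le_max_left _ _
  have hb : ‖b‖ ≤ 1 := hab ▸ le_max_right _ _
  have hc : ‖c‖ ≤ 1 := hce ▸ le_max_left _ _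
  have he : ‖e‖ ≤ 1 := hce ▸ le_max_right _ _
  have h1 := key e (-b) he (by rwa [norm_neg])
  have h2 := key (-c) a (by rwa [norm_neg]) ha
  have e1 : lin x (e * a + -b * c) (e * b + -b * e) = ‖a * e - b * c‖ * lin x 1 0 := by
    rw [← lin_mul]; congr 1 <;> ring
  have e2 : lin x (-c * a + a * c) (-c * b + a * e) = ‖a * e - b * c‖ * lin x 0 1 := by
    rw [← lin_mul]; congr 1 <;> ring
  rw [e1] at h1
  rw [e2] at h2
  rcases max_choice (lin x 1 0) (lin x 0 1) with h | h <;> rw [lin_max_eq_one] at h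
  · rwa [← h, mul_one] at h1
  · rwa [← h, mul_one] at h2

/-- Modulo an integral multiple of the second form, the first is det · X or det · Y up to a unit; a
coefficient c or e of norm 1 serves as pivot. -/
lemma lin_le_max_det (x : P1 K) {a b c e : K} (hab : max ‖a‖ ‖b‖ = 1) (hce : max ‖c‖ ‖e‖ = 1) :
    lin x a b ≤ max (lin x c e) ‖a * e - b * c‖ := by
  have ha : ‖a‖ ≤ 1 := hab ▸ le_max_left _ _
  have hb : ‖b‖ ≤ 1 := hab ▸ le_max_right _ _
  have hle := lin_max_eq_one x
  rcases max_choice ‖c‖ ‖e‖ with h | h <;> rw [hce] at h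
  · have hc0 : c ≠ 0 := by rintro rfl; simp at h
    have h1 := lin_add_le x (a / c * c) (a / c * e) ((-(a * e - b * c) / c) * 0)
      ((-(a * e - b * c) / c) * 1)
    rw [lin_mul, lin_mul, norm_div, norm_div, norm_neg, ← h, div_one, div_one] at h1
    have e1 : a / c * c + -(a * e - b * c) / c * 0 = a := by field_simp; ring
    have e2 : a / c * e + -(a * e - b * c) / c * 1 = b := by field_simp; ring
    rw [e1, e2] at h1
    refine h1.trans (max_le_max ?_ ?_)
    · exact mul_le_of_le_one_left (lin_nonneg _ _ _) ha
    · exact mul_le_of_le_one_right (norm_nonneg _) (hle ▸ le_max_right _ _)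
  · have he0 : e ≠ 0 := by rintro rfl; simp at h
    have h1 := lin_add_le x (b / e * c) (b / e * e) (((a * e - b * c) / e) * 1)
      (((a * e - b * c) / e) * 0)
    rw [lin_mul, lin_mul, norm_div, norm_div, ← h, div_one, div_one] at h1
    have e1 : b / e * c + (a * e - b * c) / e * 1 = a := by field_simp; ring
    have e2 : b / e * e + (a * e - b * c) / e * 0 = b := by field_simp; ring
    rw [e1, e2] at h1
    refine h1.trans (max_le_max ?_ ?_)
    · exact mul_le_of_le_one_left (lin_nonneg _ _ _) hb
    · exact mul_le_of_le_one_right (norm_nonneg _) (hle ▸ le_max_left _ _)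

/-- Moving up the path from x to z enlarges the value of a linear form by a factor at most diam z /
diam x: for a unit form, the value at z is at most diam z or does not exceed the value at x. -/
lemma lin_mul_diamG_le {x z : P1 K} (h : z ∈ path x) (a b : K) :
    lin z a b * diamG x ≤ diamG z * lin x a b := by
  have main : ∀ a b : K, max ‖a‖ ‖b‖ = 1 → lin z a b * diamG x ≤ diamG z * lin x a b := by
    intro a b hab
    have h1 : lin z a b ≤ max (diamG z) (lin x a b) := by
      rw [le_max_iff]
      by_contra! hc
      obtain ⟨c, e, hce, hlt⟩ := exists_lin_lt z hc.1
      have h2 := lin_le_max_det z hab hce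
      have h3 := norm_det_le_lin x hab hce
      have h4 := lin_le_of_mem_path h c e
      have h5 := h2.trans (max_le (le_max_left _ _) (h3.trans
        (max_le (le_max_right _ _) (h4.trans (le_max_left _ _))) :
        _ ≤ max (lin z c e) (lin x a b)))
      rcases le_max_iff.mp h5 with h6 | h6 <;> linarith
    have hz := diamG_nonneg z
    have hx := diamG_nonneg x
    rcases le_max_iff.mp h1 with h2 | h2
    · exact mul_le_mul h2 (diamG_le_lin x hab) hx hz
    · rw [mul_comm]
      exact mul_le_mul (diamG_le_of_mem_path h) h2 (lin_nonneg _ _ _) hz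
  obtain ⟨c, a', b', rfl, rfl, hab⟩ := exists_unit_multiple a b
  rw [lin_mul, lin_mul, mul_assoc, mul_left_comm (diamG z)]
  exact mul_le_mul_of_nonneg_left (main a' b' hab) (norm_nonneg _)

lemma gauss_mem_path (x : P1 K) : gauss ∈ path x := by
  intro n f hf
  have hX : max 1 ((gaussA1 : A1 K) X) = 1 := by
    have := gauss_linear (1 : K) 0
    rw [C_1, one_mul, C_0, add_zero, norm_one, norm_zero, max_eq_left zero_le_one] at this
    rw [this, max_self]
  change _ ≤ (gaussA1 : A1 K) f / max 1 ((gaussA1 : A1 K) X) ^ n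
  rw [hX, one_pow, div_one]
  induction x using OnePoint.rec with
  | infty => exact norm_coeff_le_gauss f n
  | coe x =>
    change x f / max 1 (x X) ^ n ≤ _
    rw [div_le_iff₀ (pow_pos x.max_pos n)]
    have h := x.heval_le n f X 1
    rwa [heval_X_one hf, x.map_one, max_comm] at h

lemma diamG_gauss : diamG (gauss : P1 K) = 1 := by
  refine le_antisymm (diamG_le_one _) (le_of_forall_unit_lin fun a b hab => ?_)
  have h := gauss_linear (1 : K) 0
  rw [C_1, one_mul, C_0, add_zero, norm_one, norm_zero, max_eq_left zero_le_one] at h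
  rw [gauss, lin_coe, gauss_linear, hab, h, max_self, div_one]

lemma bddBelow_diamG_image (S : Set (P1 K)) : BddBelow (diamG '' S) :=
  ⟨0, by rintro _ ⟨z, -, rfl⟩; exact diamG_nonneg z⟩

lemma diamWedge_le {x y z : P1 K} (hx : z ∈ path x) (hy : z ∈ path y) : diamWedge x y ≤ diamG z :=
  csInf_le (bddBelow_diamG_image _) ⟨z, ⟨hx, hy⟩, rfl⟩

lemma nonempty_diamG_image (x y : P1 K) : (diamG '' (path x ∩ path y)).Nonempty :=
  ⟨_, gauss, ⟨gauss_mem_path x, gauss_mem_path y⟩, rfl⟩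

lemma le_diamWedge_left (x y : P1 K) : diamG x ≤ diamWedge x y := by
  refine le_csInf (nonempty_diamG_image x y) ?_
  rintro _ ⟨z, hz, rfl⟩
  exact diamG_le_of_mem_path hz.1

lemma le_diamWedge_right (x y : P1 K) : diamG y ≤ diamWedge x y := by
  refine le_csInf (nonempty_diamG_image x y) ?_
  rintro _ ⟨z, hz, rfl⟩
  exact diamG_le_of_mem_path hz.2

lemma diamWedge_le_one (x y : P1 K) : diamWedge x y ≤ 1 :=
  (diamWedge_le (gauss_mem_path x) (gauss_mem_path y)).trans (diamG_le_one _)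

lemma diamWedge_gauss (x : P1 K) : diamWedge gauss x = 1 :=
  le_antisymm (diamWedge_le_one _ _) (diamG_gauss (K := K) ▸ le_diamWedge_left gauss x)

lemma rho_gauss (q : ℝ) (x : P1 K) : rho q gauss x = -Real.logb q (diamG x) := by
  rw [rho, diamWedge_gauss, diamG_gauss, Real.logb_one]
  ring

lemma abs_diamG_sub_le (x y : P1 K) : |diamG y - diamG x| ≤ smallDist x y := by
  have h1 := le_diamWedge_left x y
  have h2 := le_diamWedge_right x y
  rw [abs_le, smallDist]
  constructor <;> linarith

/-- Points that are close in the small metric have proportional normalized seminorms. -/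
lemma lin_mul_le_of_smallDist_lt {x y : P1 K} {η : ℝ} (h : smallDist x y < η) (a b : K) :
    lin y a b * diamG x ≤ (diamG x + η) * lin x a b ∧
      lin x a b * diamG y ≤ (diamG x + η) * lin y a b := by
  have h1 := le_diamWedge_right x y
  have h0 := le_diamWedge_left x y
  rw [smallDist] at h
  -- A common point z of the two paths, nearly as low as x ∧ y, replaces the meeting point itself,
  -- so attainment of the infimum is not needed.
  obtain ⟨_, ⟨z, ⟨hzx, hzy⟩, rfl⟩, hz⟩ := exists_lt_of_csInf_lt (nonempty_diamG_image x y)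
    (show diamWedge x y < diamG x + η by linarith)
  constructor
  · calc lin y a b * diamG x ≤ lin z a b * diamG x :=
          mul_le_mul_of_nonneg_right (lin_le_of_mem_path hzy a b) (diamG_nonneg x)
      _ ≤ diamG z * lin x a b := lin_mul_diamG_le hzx a b
      _ ≤ _ := mul_le_mul_of_nonneg_right hz.le (lin_nonneg _ _ _)
  · calc lin x a b * diamG y ≤ lin z a b * diamG y :=
          mul_le_mul_of_nonneg_right (lin_le_of_mem_path hzx a b) (diamG_nonneg y)
      _ ≤ diamG z * lin y a b := lin_mul_diamG_le hzy a b
      _ ≤ _ := mul_le_mul_of_nonneg_right hz.le (lin_nonneg _ _ _)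

end Linear

/-! ### Type II points as images of the Gauss point. -/

section TypeII

variable {K : Type*} [NontriviallyNormedField K]

lemma heval_natDegree_eq_sum (f p q : K[X]) :
    (f.sum fun i c => C c * p ^ i * q ^ (f.natDegree - i)) = heval f.natDegree f p q := by
  rw [heval_eq_sum, sum_over_range _ (by simp)]
  exact Finset.sum_congr rfl fun i _ => by rw [algebraMap_eq, mul_assoc]

lemma MapsPoint.apply_linear {γ : GL (Fin 2) K} {x y : A1 K} (h : MapsPoint γ x y) (a b : K) :
    y (C a * X + C b) * x (C (γ.1 1 0) * X + C (γ.1 1 1)) =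
      x (C a * (C (γ.1 0 0) * X + C (γ.1 0 1)) + C b * (C (γ.1 1 0) * X + C (γ.1 1 1))) := by
  -- `MapsPoint` clears denominators with the true degree, which drops to 0 here.
  by_cases ha : a = 0
  · rw [ha, C_0, zero_mul, zero_mul, zero_add, zero_add, y.map_C, x.map_C_mul]
  · have h1 := h.2 (C a * X + C b)
    rw [heval_natDegree_eq_sum, natDegree_linear ha, heval_linear, pow_one] at h1
    exact h1

lemma one_le_of_lin_le {x y : P1 K} {c : ℝ} (hc : ∀ a b : K, lin x a b ≤ c * lin y a b) :
    1 ≤ c := by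
  have h1 := lin_max_eq_one x
  have h2 := lin_max_eq_one y
  have hc0 : 0 ≤ c := by
    by_contra! h0
    have h3 := hc 1 0
    have h4 := hc 0 1
    have h5 := mul_nonpos_of_nonpos_of_nonneg h0.le (lin_nonneg y 1 0)
    have h6 := mul_nonpos_of_nonpos_of_nonneg h0.le (lin_nonneg y 0 1)
    have := max_le (h3.trans h5) (h4.trans h6)
    linarith
  rw [← h1]
  refine max_le ((hc _ _).trans (mul_le_of_le_one_right hc0 ?_))
    ((hc _ _).trans (mul_le_of_le_one_right hc0 ?_))
  · exact h2 ▸ le_max_left _ _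
  · exact h2 ▸ le_max_right _ _

variable [IsUltrametricDist K]

/-- The value of a form at γ(ζ_G) is the Gauss norm of its pullback by γ; normalizing by the larger
value at X, Y divides by the norm of γ. -/
lemma lin_mul_entryNorm {γ : GL (Fin 2) K} {y : A1 K} (h : MapsPoint γ gaussA1 y) (a b : K) :
    lin (y : P1 K) a b * entryNorm γ.1 =
      max ‖a * γ.1 0 0 + b * γ.1 1 0‖ ‖a * γ.1 0 1 + b * γ.1 1 1‖ := by
  set e := (gaussA1 : A1 K) (C (γ.1 1 0) * X + C (γ.1 1 1)) with he
  have hX := h.apply_linear 1 0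
  rw [C_1, C_0, one_mul, add_zero, one_mul, zero_mul, add_zero] at hX
  have hE : entryNorm γ.1 = max 1 (y X) * e := by
    rw [max_mul_of_nonneg _ _ (A1.nonneg _ _), one_mul, hX, ← pairNorm_rows, pairNorm, max_comm]
  have hab := h.apply_linear a b
  have e1 : C a * (C (γ.1 0 0) * X + C (γ.1 0 1)) + C b * (C (γ.1 1 0) * X + C (γ.1 1 1)) =
      C (a * γ.1 0 0 + b * γ.1 1 0) * X + C (a * γ.1 0 1 + b * γ.1 1 1) := by
    simp only [C_add, C_mul]; ring
  rw [e1, gauss_linear (a * γ.1 0 0 + b * γ.1 1 0)] at hab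
  rw [lin_coe, hE, ← mul_assoc, div_mul_cancel₀ _ y.max_pos.ne', hab]

/-- In logarithms, ρ(ζ_G, γ(ζ_G)) ≤ 2 log‖γ‖ - log|det γ|. Multiplying the pulled-back coefficient
row (u, v) by the adjugate of γ returns det γ · (a, b), which the ultrametric inequality bounds. -/
lemma norm_det_le_diamG_mul {γ : GL (Fin 2) K} {y : A1 K} (h : MapsPoint γ gaussA1 y) :
    ‖γ.1.det‖ ≤ diamG (y : P1 K) * entryNorm γ.1 ^ 2 := by
  have hE := entryNorm_pos γ
  rw [← div_le_iff₀ (by positivity)]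
  refine le_of_forall_unit_lin fun a b hab => ?_
  rw [div_le_iff₀ (by positivity), pow_two, ← mul_assoc, lin_mul_entryNorm h]
  set u := a * γ.1 0 0 + b * γ.1 1 0
  set v := a * γ.1 0 1 + b * γ.1 1 1
  have hu : 0 ≤ max ‖u‖ ‖v‖ := le_max_of_le_left (norm_nonneg _)
  have key : ∀ s t : K, ‖s‖ ≤ entryNorm γ.1 → ‖t‖ ≤ entryNorm γ.1 →
      ‖u * s - v * t‖ ≤ max ‖u‖ ‖v‖ * entryNorm γ.1 := by
    intro s t hs ht
    rw [sub_eq_add_neg]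
    refine (IsUltrametricDist.norm_add_le_max _ _).trans (max_le ?_ ?_)
    · rw [norm_mul]
      exact mul_le_mul (le_max_left _ _) hs (norm_nonneg _) hu
    · rw [norm_neg, norm_mul]
      exact mul_le_mul (le_max_right _ _) ht (norm_nonneg _) hu
  have h1 : u * γ.1 1 1 - v * γ.1 1 0 = γ.1.det * a := by rw [Matrix.det_fin_two]; ring
  have h2 : u * (-γ.1 0 1) - v * (-γ.1 0 0) = γ.1.det * b := by rw [Matrix.det_fin_two]; ring
  have h3 := key _ _ (norm_entry_le γ.1 1 1) (norm_entry_le γ.1 1 0)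
  have h4 := key (-γ.1 0 1) (-γ.1 0 0) (by rw [norm_neg]; exact norm_entry_le _ _ _)
    (by rw [norm_neg]; exact norm_entry_le _ _ _)
  rw [h1, norm_mul] at h3
  rw [h2, norm_mul] at h4
  rcases max_choice ‖a‖ ‖b‖ with h | h <;> rw [hab] at h
  · rwa [← h, mul_one] at h3
  · rwa [← h, mul_one] at h4

/-- Read the rows of γ⁻¹ as linear forms. Their pullbacks by γ are the coordinates, of norm 1, and
their pullbacks by γ' are the rows of γ⁻¹γ'. -/
lemma entryNorm_inv_mul_le {γ γ' : GL (Fin 2) K} {y y' : A1 K} (h : MapsPoint γ gaussA1 y)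
    (h' : MapsPoint γ' gaussA1 y') {c : ℝ}
    (hc : ∀ a b : K, lin (y' : P1 K) a b ≤ c * lin (y : P1 K) a b) :
    entryNorm (γ⁻¹ * γ' : GL (Fin 2) K).1 * entryNorm γ.1 ≤ c * entryNorm γ'.1 := by
  have hE := entryNorm_pos γ
  have hE' := entryNorm_pos γ'
  have hinv : (γ⁻¹ : GL (Fin 2) K).1 * γ.1 = 1 := by
    rw [← Units.val_mul, inv_mul_cancel, Units.val_one]
  have row : ∀ i, max ‖(γ⁻¹ * γ').1 i 0‖ ‖(γ⁻¹ * γ').1 i 1‖ * entryNorm γ.1 ≤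
      c * entryNorm γ'.1 := by
    intro i
    have h1 := lin_mul_entryNorm h ((γ⁻¹ : GL (Fin 2) K).1 i 0) ((γ⁻¹ : GL (Fin 2) K).1 i 1)
    have h2 := lin_mul_entryNorm h' ((γ⁻¹ : GL (Fin 2) K).1 i 0) ((γ⁻¹ : GL (Fin 2) K).1 i 1)
    have e1 : ∀ j, (γ⁻¹ : GL (Fin 2) K).1 i 0 * γ.1 0 j + (γ⁻¹ : GL (Fin 2) K).1 i 1 * γ.1 1 j =
        (1 : Matrix (Fin 2) (Fin 2) K) i j := by
      intro j
      rw [← hinv, Matrix.mul_apply, Fin.sum_univ_two]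
    have e2 : ∀ j, (γ⁻¹ : GL (Fin 2) K).1 i 0 * γ'.1 0 j + (γ⁻¹ : GL (Fin 2) K).1 i 1 * γ'.1 1 j =
        (γ⁻¹ * γ').1 i j := by
      intro j
      rw [Units.val_mul, Matrix.mul_apply, Fin.sum_univ_two]
    have e3 : max ‖(1 : Matrix (Fin 2) (Fin 2) K) i 0‖ ‖(1 : Matrix (Fin 2) (Fin 2) K) i 1‖ = 1 := by
      revert i
      exact Fin.forall_fin_two.mpr ⟨by simp, by simp⟩
    rw [e1, e1, e3] at h1
    rw [e2, e2] at h2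
    rw [← h2]
    have h3 := mul_le_mul_of_nonneg_right (mul_le_mul_of_nonneg_right
      (hc ((γ⁻¹ : GL (Fin 2) K).1 i 0) ((γ⁻¹ : GL (Fin 2) K).1 i 1)) hE'.le) hE.le
    refine h3.trans (le_of_eq ?_)
    rw [mul_right_comm, mul_assoc c, h1, mul_one]
  rw [entryNorm, max_mul_of_nonneg _ _ hE.le]
  exact max_le (row 0) (row 1)

/-- With c = c' = 1 this also shows that the value at a type II point does not depend on the chosen
γ. -/
lemma ordRes_conj_le_of_lin_le [IsAlgClosed K] {q : ℝ} (hq : 1 < q) {d : ℕ} (hd : 1 ≤ d)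
    {F G : K[X]} (h : NonDegenerate d F G) {γ γ' : GL (Fin 2) K} {y y' : A1 K}
    (hγ : MapsPoint γ gaussA1 y) (hγ' : MapsPoint γ' gaussA1 y') {c c' : ℝ}
    (hc : ∀ a b : K, lin (y' : P1 K) a b ≤ c * lin (y : P1 K) a b)
    (hc' : ∀ a b : K, lin (y : P1 K) a b ≤ c' * lin (y' : P1 K) a b) :
    ordRes q (conj (ratio F G) γ') ≤ ordRes q (conj (ratio F G) γ) +
      d * (d + 1) * Real.logb q (c * c') := by
  refine (ordRes_conj_le_ordRes_conj hq hd h γ γ').trans ?_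
  have h1 := entryNorm_inv_mul_le hγ hγ' hc
  have h2 := entryNorm_inv_mul_le hγ' hγ hc'
  have hE := entryNorm_pos γ
  have hE' := entryNorm_pos γ'
  have hP := entryNorm_pos (γ⁻¹ * γ')
  have hP' := entryNorm_pos (γ'⁻¹ * γ)
  have hc0 : 0 < c := one_pos.trans_le (one_le_of_lin_le hc)
  have h3 := mul_le_mul h1 h2 (by positivity) (by positivity)
  have h4 : entryNorm (γ⁻¹ * γ').1 * entryNorm (γ'⁻¹ * γ).1 ≤ c * c' := by
    rw [← mul_le_mul_iff_left₀ (mul_pos hE hE')]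
    linarith
  have := mul_le_mul_of_nonneg_left (Real.logb_le_logb_of_le hq (mul_pos hP hP') h4)
    (by positivity : (0 : ℝ) ≤ d * (d + 1))
  linarith

/-! ### Discs -/

lemma disc_X_sub (a : K) (r : ℝ) (hr : 0 < r) : (A1.disc a r hr) (X - C a) = r := by
  change (taylor a (X - C a)).gaussNorm _ r = r
  rw [map_sub, taylor_X, taylor_C, add_sub_cancel_right, ← monomial_one_one_eq_X,
    gaussNorm_monomial]
  simp

lemma mapsPoint_disc (a b : K) (hb : b ≠ 0) :
    ∃ γ : GL (Fin 2) K, MapsPoint γ gaussA1 (A1.disc a ‖b‖ (norm_pos_iff.mpr hb)) := by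
  refine ⟨Matrix.GeneralLinearGroup.mkOfDetNeZero !![b, a; 0, 1] (by simpa using hb), ?_⟩
  have h10 : (Matrix.GeneralLinearGroup.mkOfDetNeZero !![b, a; 0, 1]
      (by simpa using hb)).1 1 0 = 0 := rfl
  have h11 : (Matrix.GeneralLinearGroup.mkOfDetNeZero !![b, a; 0, 1]
      (by simpa using hb)).1 1 1 = 1 := rfl
  have h00 : (Matrix.GeneralLinearGroup.mkOfDetNeZero !![b, a; 0, 1]
      (by simpa using hb)).1 0 0 = b := rfl
  have h01 : (Matrix.GeneralLinearGroup.mkOfDetNeZero !![b, a; 0, 1]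
      (by simpa using hb)).1 0 1 = a := rfl
  have hone : C (0 : K) * X + C 1 = 1 := by simp
  refine ⟨?_, fun f => ?_⟩
  · rw [h10, h11, hone, A1.map_one]
    exact one_ne_zero
  · rw [heval_natDegree_eq_sum, h10, h11, h00, h01, hone, A1.map_one, one_pow, mul_one,
      heval_one_right le_rfl]
    have e : aeval (C b * X + C a) f = (taylor a f).comp (C b * X) := by
      rw [taylor_apply, comp_assoc, ← comp_eq_aeval]
      simp
    rw [e]
    have hc : ∀ i, ‖((taylor a f).comp (C b * X)).coeff i‖ = ‖(taylor a f).coeff i‖ * ‖b‖ ^ i := by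
      intro i
      rw [comp_C_mul_X_coeff, norm_mul, norm_pow]
    apply le_antisymm
    · obtain ⟨i, hi⟩ := exists_eq_gaussNorm (NormedField.toAbsoluteValue K) ‖b‖ (taylor a f)
      change (taylor a f).gaussNorm _ ‖b‖ ≤ _
      rw [hi]
      exact (hc i).symm.le.trans (norm_coeff_le_gauss _ i)
    · rw [gauss_le_iff]
      intro i
      rw [hc]
      exact le_gaussNorm (NormedField.toAbsoluteValue K) (taylor a f) (norm_nonneg b) i

lemma exists_mapsPoint_of_mem_typeII {x : P1 K} (hx : x ∈ typeII) :
    ∃ (γ : GL (Fin 2) K) (y : A1 K), x = (y : P1 K) ∧ MapsPoint γ gaussA1 y := by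
  obtain ⟨a, b, hb, rfl⟩ := hx
  obtain ⟨γ, hγ⟩ := mapsPoint_disc a b hb
  exact ⟨γ, _, rfl, hγ⟩

lemma exists_ordResII_eq {x : P1 K} (hx : x ∈ typeII) :
    ∃ (γ : GL (Fin 2) K) (y : A1 K), x = (y : P1 K) ∧ MapsPoint γ gaussA1 y ∧
      ∀ (q : ℝ) (φ : RatFunc K), ordResII q φ x = ordRes q (conj φ γ) := by
  have h := exists_mapsPoint_of_mem_typeII hx
  exact ⟨h.choose, h.choose_spec.choose, h.choose_spec.choose_spec.1, h.choose_spec.choose_spec.2,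
    fun q φ => by rw [ordResII, dif_pos h]⟩

lemma gauss_mem_typeII : (gauss : P1 K) ∈ typeII := by
  refine ⟨0, 1, one_ne_zero, ?_⟩
  simp only [gauss, gaussA1, norm_one]

lemma mapsPoint_one_gauss : MapsPoint (1 : GL (Fin 2) K) gaussA1 gaussA1 := by
  have h10 : (1 : GL (Fin 2) K).1 1 0 = 0 := rfl
  have h11 : (1 : GL (Fin 2) K).1 1 1 = 1 := rfl
  have h00 : (1 : GL (Fin 2) K).1 0 0 = 1 := rfl
  have h01 : (1 : GL (Fin 2) K).1 0 1 = 0 := rfl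
  have hone : C (0 : K) * X + C 1 = 1 := by simp
  have hX : C (1 : K) * X + C 0 = X := by simp
  refine ⟨?_, fun f => ?_⟩
  · rw [h10, h11, hone, A1.map_one]
    exact one_ne_zero
  · rw [heval_natDegree_eq_sum, h10, h11, h00, h01, hone, hX, heval_X_one le_rfl, A1.map_one,
      one_pow, mul_one]

/-- Two type II points whose normalized seminorms are proportional have close values of the
function `ordRes`. -/
lemma ordResII_le_of_lin_le [IsAlgClosed K] {q : ℝ} (hq : 1 < q) {d : ℕ} (hd : 1 ≤ d)
    {F G : K[X]} (h : NonDegenerate d F G) {x y : P1 K} (hx : x ∈ typeII) (hy : y ∈ typeII)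
    {c : ℝ} (hc : ∀ a b : K, lin y a b ≤ c * lin x a b)
    (hc' : ∀ a b : K, lin x a b ≤ c * lin y a b) :
    ordResII q (ratio F G) y ≤ ordResII q (ratio F G) x + d * (d + 1) * Real.logb q (c * c) := by
  obtain ⟨γ, x, rfl, hγ, e⟩ := exists_ordResII_eq hx
  obtain ⟨γ', y, rfl, hγ', e'⟩ := exists_ordResII_eq hy
  rw [e, e']
  exact ordRes_conj_le_of_lin_le hq hd h hγ hγ' hc hc'

/-- The γ chosen in `ordResII` need not be the identity; compare it with the identity using
constants 1. -/
lemma ordResII_gauss_le [IsAlgClosed K] {q : ℝ} (hq : 1 < q) {d : ℕ} (hd : 1 ≤ d)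
    {F G : K[X]} (h : NonDegenerate d F G) :
    ordResII q (ratio F G) gauss ≤ ordRes q (ratio F G) := by
  obtain ⟨γ, y, hy, hγ, e⟩ := exists_ordResII_eq (gauss_mem_typeII (K := K))
  have hle : ∀ a b : K, lin (y : P1 K) a b ≤ 1 * lin (gauss : P1 K) a b := by
    intro a b
    rw [hy, one_mul]
  have hle' : ∀ a b : K, lin (gauss : P1 K) a b ≤ 1 * lin (y : P1 K) a b := by
    intro a b
    rw [hy, one_mul]
  have := ordRes_conj_le_of_lin_le hq hd h mapsPoint_one_gauss hγ hle hle'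
  rwa [mul_one, Real.logb_one, mul_zero, add_zero, conj_one hd h, ← e] at this

lemma diamG_pos_of_mem_typeII {x : P1 K} (hx : x ∈ typeII) : 0 < diamG x := by
  obtain ⟨γ, y, rfl, hγ⟩ := exists_mapsPoint_of_mem_typeII hx
  have h := norm_det_le_diamG_mul hγ
  have h0 : 0 < ‖γ.1.det‖ := by simpa using det_ne_zero γ
  by_contra! hc
  have := mul_nonpos_of_nonpos_of_nonneg hc (sq_nonneg (entryNorm γ.1))
  linarith

/-- Lower bound for the function `ordRes` of an iterate in terms of the distance to the Gauss
point. -/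
lemma le_ordResII_iter [IsAlgClosed K] {q : ℝ} (hq : 1 < q) {d : ℕ} (hd : 2 ≤ d) {F G : K[X]}
    (h : NonDegenerate d F G) (hFG : pairNorm F G = 1) (n : ℕ) {x : P1 K} (hx : x ∈ typeII) :
    ordResII q (iter (ratio F G) n) gauss +
      d ^ n * (d ^ n - 1) * (-Real.logb q (diamG x) - 2 / (d - 1) * ordRes q (ratio F G)) ≤
      ordResII q (iter (ratio F G) n) x := by
  have hd1 : 1 ≤ d := by omega
  have hN : 1 ≤ d ^ n := Nat.one_le_pow _ _ hd1
  have hpos := diamG_pos_of_mem_typeII hx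
  obtain ⟨γ, y, rfl, hγ, e⟩ := exists_ordResII_eq hx
  have h1 := le_ordRes_conj_iter hq hd h hFG n γ
  have h2 := ordResII_gauss_le hq hN (h.iterLift n)
  have hE := entryNorm_pos γ
  have h0 : 0 < ‖γ.1.det‖ := by simpa using det_ne_zero γ
  have h3 := Real.logb_le_logb_of_le hq h0 (norm_det_le_diamG_mul hγ)
  rw [Real.logb_mul hpos.ne' (by positivity), Real.logb_pow] at h3
  push_cast at h3
  rw [iter_ratio hd1 h, e]
  have hNr : (1 : ℝ) ≤ (d : ℝ) ^ n := by exact_mod_cast hN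
  have h4 : 0 ≤ (d : ℝ) ^ n * ((d : ℝ) ^ n - 1) :=
    mul_nonneg (by positivity) (by linarith)
  have h5 := mul_le_mul_of_nonneg_left
    (show -Real.logb q (diamG (y : P1 K)) - 2 / (d - 1) * ordRes q (ratio F G) ≤
      2 * Real.logb q (entryNorm γ.1) - Real.logb q ‖γ.1.det‖ -
        2 / (d - 1) * ordRes q (ratio F G) by linarith) h4
  linarith

end TypeII

/-! ### Approximating every point by type II points. -/

section Approximation

variable {K : Type*} [NontriviallyNormedField K]

/-- The value group is dense: a high root e of an element of norm greater than 1 has norm just above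
1, and some power of e lands in the interval. -/
lemma exists_norm_between [IsAlgClosed K] {s t : ℝ} (hs : 0 ≤ s) (hst : s < t) :
    ∃ b : K, b ≠ 0 ∧ s < ‖b‖ ∧ ‖b‖ < t := by
  obtain ⟨u, hu, hut⟩ := exists_between hst
  have hu0 : 0 < u := hs.trans_lt hu
  have hr : 1 < t / u := (one_lt_div hu0).mpr hut
  obtain ⟨c, hc⟩ := NormedField.exists_one_lt_norm K
  obtain ⟨m, hm⟩ := pow_unbounded_of_one_lt ‖c‖ hr
  have hm0 : 0 < m := by
    rcases Nat.eq_zero_or_pos m with rfl | h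
    · rw [pow_zero] at hm; linarith
    · exact h
  obtain ⟨e, he⟩ := IsAlgClosed.exists_pow_nat_eq c hm0
  have hen : ‖e‖ ^ m = ‖c‖ := by rw [← norm_pow, he]
  have he1 : 1 < ‖e‖ := by
    by_contra! h
    have := pow_le_one₀ (n := m) (norm_nonneg e) h
    linarith
  have het : ‖e‖ < t / u := by
    refine lt_of_pow_lt_pow_left₀ m (by linarith) ?_
    rw [hen]
    exact hm
  obtain ⟨k, hk1, hk2⟩ := exists_mem_Ico_zpow (y := ‖e‖) hu0 he1
  have hpos : 0 < ‖e‖ ^ k := zpow_pos (by linarith) k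
  refine ⟨e ^ (k + 1), ?_, ?_, ?_⟩
  · exact zpow_ne_zero _ (norm_pos_iff.mp (by linarith))
  · rw [norm_zpow]; linarith
  · rw [norm_zpow, zpow_add_one₀ (by linarith)]
    calc ‖e‖ ^ k * ‖e‖ ≤ u * ‖e‖ := mul_le_mul_of_nonneg_right hk1 (norm_nonneg _)
      _ < u * (t / u) := mul_lt_mul_of_pos_left het hu0
      _ = t := mul_div_cancel₀ t hu0.ne'

variable [IsUltrametricDist K]

lemma disc_X_le (a : K) (r : ℝ) (hr : 0 < r) : (A1.disc a r hr) X ≤ max r ‖a‖ := by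
  have h := (A1.disc a r hr).add_le_max (X - C a) (C a)
  rwa [sub_add_cancel, disc_X_sub, A1.map_C] at h

lemma le_disc_X (a : K) (r : ℝ) (hr : 0 < r) : r ≤ max ((A1.disc a r hr) X) ‖a‖ := by
  have h := (A1.disc a r hr).add_le_max X (-C a)
  rwa [← sub_eq_add_neg, disc_X_sub, A1.map_neg, A1.map_C] at h

lemma norm_le_disc_X (a : K) (r : ℝ) (hr : 0 < r) (h : r < ‖a‖) : ‖a‖ ≤ (A1.disc a r hr) X := by
  have h := (A1.disc a r hr).add_le_max X (-(X - C a))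
  rw [← sub_eq_add_neg, sub_sub_cancel, A1.map_C, A1.map_neg, disc_X_sub] at h
  rcases le_max_iff.mp h with h | h
  · exact h
  · linarith

lemma le_disc (a : K) (r : ℝ) (hr : 0 < r) (f : K[X]) (i : ℕ) :
    ‖(taylor a f).coeff i‖ * r ^ i ≤ (A1.disc a r hr) f :=
  le_gaussNorm (NormedField.toAbsoluteValue K) (taylor a f) hr.le i

/-- Expand f in powers of T - a and compare term by term: `h2` controls the i factors T - a, `h1`
the other n - i normalizing factors. -/
lemma disc_mem_path (x : A1 K) (a : K) (r : ℝ) (hr : 0 < r)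
    (h1 : max 1 ((A1.disc a r hr) X) ≤ max 1 (x X))
    (h2 : x (X - C a) * max 1 ((A1.disc a r hr) X) ≤ r * max 1 (x X)) :
    ((A1.disc a r hr : A1 K) : P1 K) ∈ path (x : P1 K) := by
  intro n f hf
  set y := A1.disc a r hr with hy
  change x f / max 1 (x X) ^ n ≤ y f / max 1 (y X) ^ n
  have hMx := x.max_pos
  have hMy := y.max_pos
  set Mx := max 1 (x X)
  set My := max 1 (y X)
  rw [div_le_iff₀ (by positivity)]
  have hf' : f = ∑ i ∈ Finset.range (n + 1), C ((taylor a f).coeff i) * (X - C a) ^ i := by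
    conv_lhs => rw [← sum_taylor_eq f a]
    exact sum_over_range' _ (by simp) _ (by rw [natDegree_taylor]; omega)
  have hyf := y.nonneg f
  conv_lhs => rw [hf']
  refine x.sum_le _ _ (by positivity) fun i hi => ?_
  have hi : i ≤ n := Nat.lt_succ_iff.mp (Finset.mem_range.mp hi)
  rw [x.map_C_mul, x.map_pow, div_mul_eq_mul_div, le_div_iff₀ (by positivity)]
  have h0 := x.nonneg (X - C a)
  calc ‖(taylor a f).coeff i‖ * x (X - C a) ^ i * My ^ n
      = ‖(taylor a f).coeff i‖ * (x (X - C a) * My) ^ i * My ^ (n - i) := by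
        rw [mul_pow, ← Nat.add_sub_cancel' hi, pow_add, Nat.add_sub_cancel_left]; ring
    _ ≤ ‖(taylor a f).coeff i‖ * (r * Mx) ^ i * Mx ^ (n - i) := by gcongr
    _ = ‖(taylor a f).coeff i‖ * r ^ i * Mx ^ n := by
        rw [mul_pow, ← Nat.add_sub_cancel' hi, pow_add, Nat.add_sub_cancel_left]; ring
    _ ≤ y f * Mx ^ n := by
        gcongr
        exact le_disc a r hr f i

/-- Every point is a limit of type II points on its path to the Gauss point. -/
lemma exists_typeII_mem_path [IsAlgClosed K] (x : P1 K) {t : ℝ} (ht : diamG x < t) :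
    ∃ y ∈ typeII, y ∈ path x ∧ diamG y < t := by
  by_cases ht1 : 1 < t
  · exact ⟨gauss, gauss_mem_typeII, gauss_mem_path x, by rwa [diamG_gauss]⟩
  push Not at ht1
  have ht0 : 0 < t := (diamG_nonneg x).trans_lt ht
  have hinv : 1 ≤ 1 / t := one_le_one_div ht0 ht1
  -- Large discs about 0 approximate ∞; their diameter is at most the inverse of the radius.
  have key : ∀ (b : K) (hb : b ≠ 0), 1 / t < ‖b‖ →
      diamG ((A1.disc 0 ‖b‖ (norm_pos_iff.mpr hb) : A1 K) : P1 K) < t := by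
    intro b hb hlt
    refine (diamG_le_lin _ (a := 0) (b := 1) (by simp)).trans_lt ?_
    have hy := le_disc_X (0 : K) ‖b‖ (norm_pos_iff.mpr hb)
    rw [norm_zero, max_eq_left (A1.nonneg _ _)] at hy
    rw [lin_coe, C_0, zero_mul, zero_add, C_1, A1.map_one, div_lt_iff₀ (A1.max_pos _),
      ← div_lt_iff₀' ht0]
    exact hlt.trans_le (hy.trans (le_max_right _ _))
  induction x using OnePoint.rec with
  | infty =>
    obtain ⟨b, hb, h1, -⟩ := exists_norm_between (K := K) (by positivity) (lt_add_one (1 / t))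
    refine ⟨_, ⟨0, b, hb, rfl⟩, ?_, key b hb h1⟩
    intro n f hf
    change ‖f.coeff n‖ ≤ (A1.disc 0 ‖b‖ _) f / max 1 ((A1.disc 0 ‖b‖ _) X) ^ n
    have h2 := disc_X_le (0 : K) ‖b‖ (norm_pos_iff.mpr hb)
    rw [norm_zero, max_eq_left (norm_nonneg _)] at h2
    have h3 := le_disc (0 : K) ‖b‖ (norm_pos_iff.mpr hb) f n
    rw [taylor_zero] at h3
    rw [le_div_iff₀ (pow_pos (A1.max_pos _) n)]
    refine le_trans (mul_le_mul_of_nonneg_left (pow_le_pow_left₀ (A1.max_pos _).le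
      (max_le ?_ h2) n) (norm_nonneg _)) h3
    linarith
  | coe x =>
    obtain ⟨α, β, hαβ, hlt⟩ := exists_lin_lt _ ht
    have hα1 : ‖α‖ ≤ 1 := hαβ ▸ le_max_left _ _
    have hβ1 : ‖β‖ ≤ 1 := hαβ ▸ le_max_right _ _
    rw [lin_coe] at hlt
    have hroot : α ≠ 0 → ∀ z : A1 K, z (C α * X + C β) = ‖α‖ * z (X - C (-(β / α))) := by
      intro h0 z
      rw [← z.map_C_mul, mul_sub, ← C_mul, mul_neg, mul_div_cancel₀ _ h0, C_neg, sub_neg_eq_add]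
    rcases le_or_gt (x X) 1 with hx | hx
    · rw [max_eq_left hx, div_one] at hlt
      have hα : ‖α‖ = 1 := by
        rcases hα1.eq_or_lt with h | h
        · exact h
        · have hβ : ‖β‖ = 1 := by
            rcases max_choice ‖α‖ ‖β‖ with h' | h' <;> rw [hαβ] at h'
            · linarith
            · exact h'.symm
          linarith [x.one_le_linear hx h hβ]
      have hα0 : α ≠ 0 := by rintro rfl; simp at hα
      rw [hroot hα0, hα, one_mul] at hlt
      obtain ⟨b, hb, h1, h2⟩ := exists_norm_between (K := K) (x.nonneg _) hlt
      have ha : ‖-(β / α)‖ ≤ 1 := by rwa [norm_neg, norm_div, hα, div_one]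
      have hM : max 1 ((A1.disc (-(β / α)) ‖b‖ (norm_pos_iff.mpr hb)) X) = 1 :=
        max_eq_left ((disc_X_le _ _ _).trans (max_le (by linarith) ha))
      refine ⟨_, ⟨-(β / α), b, hb, rfl⟩, disc_mem_path x _ _ _ ?_ ?_, ?_⟩
      · rw [hM]; exact le_max_left _ _
      · rw [hM, max_eq_left hx, mul_one, mul_one]; exact h1.le
      · refine (diamG_le_lin _ hαβ).trans_lt ?_
        rw [lin_coe, hM, div_one, hroot hα0, hα, one_mul, disc_X_sub]
        exact h2
    · have hX0 : 0 < x X := by linarith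
      rw [max_eq_right hx.le, div_lt_iff₀ hX0] at hlt
      rcases lt_or_ge (x (C α * X + C β)) 1 with hv | hv
      · have hαX : ‖α‖ * x X = 1 := by
          have hle : ‖α‖ * x X ≤ 1 := by
            by_contra! h
            linarith [x.le_linear (a := α) (b := β) (by linarith)]
          have hα : ‖α‖ < 1 := by
            by_contra! h
            nlinarith
          have hβ : ‖β‖ = 1 := by
            rcases max_choice ‖α‖ ‖β‖ with h' | h' <;> rw [hαβ] at h'
            · linarith
            · exact h'.symm
          refine le_antisymm hle ?_
          have h := x.le_max_of_add (C α * X) (C β)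
          rw [x.map_C, hβ, x.map_C_mul] at h
          rcases le_max_iff.mp h with h | h
          · linarith
          · exact h
        have hα0 : α ≠ 0 := by rintro rfl; simp at hαX
        have hαp : 0 < ‖α‖ := norm_pos_iff.mpr hα0
        have hβ : ‖β‖ = 1 := by
          rcases max_choice ‖α‖ ‖β‖ with h' | h' <;> rw [hαβ] at h'
          · rw [← h'] at hαX; linarith
          · exact h'.symm
        have ha : ‖-(β / α)‖ = x X := by
          rw [norm_neg, norm_div, hβ, div_eq_iff hαp.ne', mul_comm, hαX]
        rw [hroot hα0] at hv hlt
        -- A disc of radius r < |a| about a centre a with |a| = |T|_x > 1 has normalized value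
        -- r/|a|² at the form αX + βY; this explains the bound t|T|_x² on the radius.
        have h1 : x (X - C (-(β / α))) < min (x X) (t * x X * x X) := by
          rw [lt_min_iff]
          constructor
          · by_contra! h
            have := mul_le_mul_of_nonneg_left h hαp.le
            linarith
          · have := mul_lt_mul_of_pos_right hlt hX0
            rwa [mul_right_comm, hαX, one_mul] at this
        obtain ⟨b, hb, h2, h3⟩ := exists_norm_between (K := K) (x.nonneg _) h1
        rw [lt_min_iff] at h3
        have hM1 := norm_le_disc_X (-(β / α)) ‖b‖ (norm_pos_iff.mpr hb) (by rw [ha]; exact h3.1)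
        have hM2 := disc_X_le (-(β / α)) ‖b‖ (norm_pos_iff.mpr hb)
        rw [ha, max_eq_right h3.1.le] at hM2
        rw [ha] at hM1
        have hM := le_antisymm hM2 hM1
        refine ⟨_, ⟨-(β / α), b, hb, rfl⟩, disc_mem_path x _ _ _ ?_ ?_, ?_⟩
        · rw [hM]
        · rw [hM]
          exact mul_le_mul_of_nonneg_right h2.le x.max_pos.le
        · refine (diamG_le_lin _ hαβ).trans_lt ?_
          rw [lin_coe, hM, hroot hα0, disc_X_sub, max_eq_right hx.le, div_lt_iff₀ hX0]
          have := mul_lt_mul_of_pos_left h3.2 hαp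
          have e : ‖α‖ * (t * x X * x X) = t * x X := by
            linear_combination t * x X * hαX
          linarith
      -- Here the form gives only |T|_x > 1/t, so x is close enough to ∞ for a large disc about 0.
      · have h1 : 1 / t < x X := by
          rw [div_lt_iff₀' ht0]
          linarith
        obtain ⟨b, hb, h2, h3⟩ := exists_norm_between (K := K) (by positivity) h1
        have hM2 := disc_X_le (0 : K) ‖b‖ (norm_pos_iff.mpr hb)
        rw [norm_zero, max_eq_left (norm_nonneg _)] at hM2
        have hM : max 1 ((A1.disc (0 : K) ‖b‖ (norm_pos_iff.mpr hb)) X) ≤ ‖b‖ :=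
          max_le (by linarith) hM2
        refine ⟨_, ⟨0, b, hb, rfl⟩, disc_mem_path x _ _ _ ?_ ?_, key b hb h2⟩
        · rw [max_eq_right hx.le]
          linarith
        · rw [max_eq_right hx.le, C_0, sub_zero, mul_comm]
          exact mul_le_mul_of_nonneg_right hM hX0.le

/-- The filter of type II points tending to `x` in the small metric. -/
def approach (x : P1 K) : Filter (P1 K) := comap (smallDist x) (𝓝 0) ⊓ 𝓟 typeII

lemma mem_approach (x : P1 K) {η : ℝ} (hη : 0 < η) :
    {y | y ∈ typeII ∧ smallDist x y < η} ∈ approach x := by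
  rw [Set.ofPred_and, Set.inter_comm]
  exact inter_mem_inf (preimage_mem_comap (Iio_mem_nhds hη)) (mem_principal_self _)

lemma smallDist_of_mem_path {x y : P1 K} (h : y ∈ path x) :
    smallDist x y = diamG y - diamG x := by
  have h1 : diamWedge x y = diamG y :=
    le_antisymm (diamWedge_le h (mem_path_self y)) (le_diamWedge_right x y)
  rw [smallDist, h1]
  ring

lemma ordResFun_of_not_mem_typeII {q : ℝ} {φ : RatFunc K} {x : P1 K} (hx : x ∉ typeII) :
    ordResFun q φ x = limUnder (approach x) (fun y => (ordResII q φ y : EReal)) := by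
  rw [ordResFun, if_neg hx, approach]

/-- Nontriviality of the filter makes limits unique, so that `limUnder` returns the limit once one
is found. -/
instance approach_neBot [IsAlgClosed K] (x : P1 K) : (approach x).NeBot := by
  rw [approach, ((Metric.nhds_basis_ball.comap (smallDist x)).inf_principal typeII).neBot_iff]
  intro ε hε
  obtain ⟨y, hy, hyx, hd⟩ := exists_typeII_mem_path x (show diamG x < diamG x + ε by linarith)
  refine ⟨y, ?_, hy⟩
  rw [Set.mem_preimage, Metric.mem_ball, Real.dist_eq, sub_zero, smallDist_of_mem_path hyx,
    abs_of_nonneg (by linarith [diamG_le_of_mem_path hyx])]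
  linarith

lemma tendsto_diamG (x : P1 K) : Tendsto diamG (approach x) (𝓝 (diamG x)) := by
  have h : Tendsto (smallDist x) (approach x) (𝓝 0) := tendsto_comap.mono_left inf_le_left
  rw [tendsto_iff_dist_tendsto_zero]
  exact squeeze_zero (fun _ => dist_nonneg) (fun y => abs_diamG_sub_le x y) h

end Approximation


/-! ### The extension of ordRes and its minimum. -/

section Extension

variable {K : Type*} [NontriviallyNormedField K] [IsUltrametricDist K] [IsAlgClosed K]

/-- The function `ordRes` has a finite limit at points of positive diameter. -/
lemma exists_tendsto_ordResII {q : ℝ} (hq : 1 < q) {d : ℕ} (hd : 1 ≤ d) {F G : K[X]}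
    (h : NonDegenerate d F G) {x : P1 K} (hx : 0 < diamG x) :
    ∃ L : ℝ, Tendsto (ordResII q (ratio F G)) (approach x) (𝓝 L) := by
  rw [← cauchy_map_iff_exists_tendsto, Metric.cauchy_iff]
  refine ⟨inferInstance, fun ε hε => ?_⟩
  set D := diamG x with hD
  -- Comparing y with y' through x costs (D + η)/(D - η) twice.
  let b : ℝ → ℝ := fun η => ((D + η) / (D - η)) ^ 2
  have hcont : Tendsto (fun η => d * (d + 1) * Real.logb q (b η * b η)) (𝓝[>] 0) (𝓝 0) := by
    have hb : ContinuousAt b 0 := by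
      refine ContinuousAt.pow (ContinuousAt.div (by fun_prop) (by fun_prop) ?_) 2
      rw [sub_zero]; exact hx.ne'
    have hb0 : b 0 = 1 := by simp [b, div_self hx.ne']
    have hl : ContinuousAt (fun η => d * (d + 1) * Real.logb q (b η * b η)) 0 := by
      refine continuousAt_const.mul (ContinuousAt.logb (hb.mul hb) ?_)
      rw [hb0]; norm_num
    have := hl.tendsto
    rw [hb0, mul_one, Real.logb_one, mul_zero] at this
    exact this.mono_left nhdsWithin_le_nhds
  obtain ⟨η, hη1, hη0, hηD⟩ : ∃ η : ℝ, d * (d + 1) * Real.logb q (b η * b η) < ε / 2 ∧ 0 < η ∧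
      η < D := by
    have h1 := hcont.eventually (Iio_mem_nhds (half_pos hε))
    have h2 : ∀ᶠ η in 𝓝[>] (0 : ℝ), 0 < η := self_mem_nhdsWithin
    have h3 : ∀ᶠ η in 𝓝[>] (0 : ℝ), η < D :=
      mem_nhdsWithin_of_mem_nhds (Iio_mem_nhds hx)
    exact (h1.and (h2.and h3)).exists
  have hb : ∀ y y' : P1 K, smallDist x y < η → smallDist x y' < η →
      ∀ s t : K, lin y' s t ≤ b η * lin y s t := by
    intro y y' hy hy' s t
    have h1 := (lin_mul_le_of_smallDist_lt hy s t).2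
    have h2 := (lin_mul_le_of_smallDist_lt hy' s t).1
    have h3 : D - η ≤ diamG y := by
      have := (abs_le.mp (abs_diamG_sub_le x y)).1
      linarith
    have hDη : 0 < D - η := by linarith
    have h4 : lin x s t ≤ (D + η) / (D - η) * lin y s t := by
      rw [div_mul_eq_mul_div, le_div_iff₀ hDη]
      exact (mul_le_mul_of_nonneg_left h3 (lin_nonneg _ _ _)).trans h1
    have h5 : lin y' s t ≤ (D + η) / (D - η) * lin x s t := by
      rw [div_mul_eq_mul_div, le_div_iff₀ hDη]
      exact (mul_le_mul_of_nonneg_left (by linarith) (lin_nonneg _ _ _)).trans h2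
    have h6 : 0 ≤ (D + η) / (D - η) := div_nonneg (by linarith) hDη.le
    calc lin y' s t ≤ (D + η) / (D - η) * ((D + η) / (D - η) * lin y s t) :=
          h5.trans (mul_le_mul_of_nonneg_left h4 h6)
      _ = _ := by simp only [b]; ring
  refine ⟨_, image_mem_map (mem_approach x hη0), ?_⟩
  rintro _ ⟨y, hy, rfl⟩ _ ⟨y', hy', rfl⟩
  have h1 := ordResII_le_of_lin_le hq hd h hy.1 hy'.1 (hb y y' hy.2 hy'.2) (hb y' y hy'.2 hy.2)
  have h2 := ordResII_le_of_lin_le hq hd h hy'.1 hy.1 (hb y' y hy'.2 hy.2) (hb y y' hy.2 hy'.2)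
  rw [Real.dist_eq, abs_lt]
  constructor <;> linarith

/-- At a point of the minimal resultant locus of an iterate, the diameter is bounded below. -/
lemma diamG_of_mem_minResLoc {q : ℝ} (hq : 1 < q) {d : ℕ} (hd : 2 ≤ d) {F G : K[X]}
    (h : NonDegenerate d F G) (hFG : pairNorm F G = 1) {n : ℕ} (hn : 1 ≤ n) {x : P1 K}
    (hx : x ∈ MinResLoc q (iter (ratio F G) n)) :
    0 < diamG x ∧ -Real.logb q (diamG x) ≤ 2 / (d - 1) * ordRes q (ratio F G) := by
  set R := 2 / ((d : ℝ) - 1) * ordRes q (ratio F G) with hR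
  set ψ := iter (ratio F G) n with hψ
  -- Minimality is used only against the Gauss point, where the value is finite.
  have hmin := hx gauss
  rw [show ordResFun q ψ gauss = (ordResII q ψ gauss : EReal) from if_pos gauss_mem_typeII] at hmin
  have hbound := fun {y : P1 K} (hy : y ∈ typeII) => le_ordResII_iter hq hd h hFG n hy
  simp only [← hR, ← hψ] at hbound
  have hN : (1 : ℝ) < (d : ℝ) ^ n := one_lt_pow₀ (by exact_mod_cast hd) (by omega)
  have hc : 0 < (d : ℝ) ^ n * ((d : ℝ) ^ n - 1) := mul_pos (by linarith) (by linarith)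
  set c := (d : ℝ) ^ n * ((d : ℝ) ^ n - 1)
  set m := ordResII q ψ gauss
  by_cases hII : x ∈ typeII
  · rw [ordResFun, if_pos hII, EReal.coe_le_coe_iff] at hmin
    refine ⟨diamG_pos_of_mem_typeII hII, ?_⟩
    have h1 := hbound hII
    by_contra! hlt
    have := mul_pos hc (sub_pos.mpr hlt)
    linarith
  · rw [ordResFun_of_not_mem_typeII hII] at hmin
    have hev : ∀ᶠ y in approach x, y ∈ typeII :=
      Filter.mem_of_superset (mem_approach x one_pos) fun y hy => hy.1
    have hev' : ∀ᶠ y in approach x, m + c * (-Real.logb q (diamG y) - R) ≤ ordResII q ψ y :=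
      hev.mono fun y hy => hbound hy
    rcases (diamG_nonneg x).eq_or_lt with h0 | h0
    -- At diameter 0 the lower bound tends to infinity, so the extension takes the value ⊤.
    · exfalso
      have hd0 : Tendsto diamG (approach x) (𝓝[>] 0) := by
        refine tendsto_nhdsWithin_iff.mpr ⟨?_, hev.mono fun y hy => diamG_pos_of_mem_typeII hy⟩
        have := tendsto_diamG x
        rwa [← h0] at this
      have h1 : Tendsto (fun y => m + c * (-Real.logb q (diamG y) - R)) (approach x) atTop := by
        refine tendsto_atTop_add_const_left _ _ (Tendsto.const_mul_atTop hc ?_)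
        simp only [sub_eq_add_neg]
        refine tendsto_atTop_add_const_right _ _ (tendsto_neg_atBot_atTop.comp ?_)
        exact (Real.tendsto_logb_nhdsGT_zero hq).comp hd0
      have h2 : Tendsto (ordResII q ψ) (approach x) atTop := tendsto_atTop_mono' _ hev' h1
      have h3 : Tendsto (fun y => (ordResII q ψ y : EReal)) (approach x) (𝓝 ⊤) :=
        EReal.tendsto_coe_nhds_top_iff.mpr h2
      rw [h3.limUnder_eq, top_le_iff] at hmin
      exact EReal.coe_ne_top _ hmin
    · refine ⟨h0, ?_⟩
      have hd1 : 1 ≤ d := by omega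
      -- Without convergence `limUnder` would carry no information; a finite limit lets the bound
      -- pass to x.
      obtain ⟨L, hL⟩ := exists_tendsto_ordResII hq (Nat.one_le_pow n d hd1) (h.iterLift n) h0
      rw [← iter_ratio hd1 h] at hL
      have h3 : Tendsto (fun y => (ordResII q ψ y : EReal)) (approach x) (𝓝 (L : EReal)) :=
        EReal.tendsto_coe.mpr hL
      rw [h3.limUnder_eq, EReal.coe_le_coe_iff] at hmin
      have h1 : Tendsto (fun y => m + c * (-Real.logb q (diamG y) - R)) (approach x)
          (𝓝 (m + c * (-Real.logb q (diamG x) - R))) :=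
        (((((tendsto_diamG x).logb h0.ne').neg).sub_const R).const_mul c).const_add m
      have h4 := le_of_tendsto_of_tendsto h1 hL hev'
      by_contra! hlt
      have := mul_pos hc (sub_pos.mpr hlt)
      linarith

end Extension

end Berk

end

theorem corollary5p3 {K : Type*} [NontriviallyNormedField K] [IsUltrametricDist K]
    [CompleteSpace K] [IsAlgClosed K] (q : ℝ) (hq : 1 < q)
    (φ : RatFunc K) (hφ : 2 ≤ Berk.deg φ) (n : ℕ) (hn : 1 ≤ n) :
    Berk.MinResLoc q (Berk.iter φ n) ⊆
        Berk.rhoBall q Berk.gauss (2 / ((Berk.deg φ : ℝ) - 1) * Berk.ordRes q φ) ∧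
      Berk.rhoDiam q (Berk.MinResLoc q (Berk.iter φ n)) ≤
        ((4 / ((Berk.deg φ : ℝ) - 1) * Berk.ordRes q φ : ℝ) : EReal) := by
  obtain ⟨F, G, hl⟩ := Berk.exists_isNormalizedLift φ
  have key : ∀ x ∈ Berk.MinResLoc q (Berk.iter φ n), 0 < Berk.diamG x ∧
      -Real.logb q (Berk.diamG x) ≤ 2 / ((Berk.deg φ : ℝ) - 1) * Berk.ordRes q φ := by
    intro x hx
    have hr : Berk.ratio F G = φ := hl.eq_div.symm
    have := Berk.diamG_of_mem_minResLoc hq hφ (Berk.nonDegenerate_of_isNormalizedLift hl)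
      hl.pairNorm_eq_one hn (x := x) (by rwa [hr])
    rwa [hr] at this
  refine ⟨fun x hx => ⟨fun hI => ?_, ?_⟩, ?_⟩
  · exact (key x hx).1.ne' (Berk.diamG_of_mem_typeI hI)
  · rw [Berk.rho_gauss]
    exact (key x hx).2
  · refine iSup₂_le fun x hx => iSup₂_le fun y hy => ?_
    rw [EReal.coe_le_coe_iff, Berk.rho]
    -- As x ∧ y has diameter at most 1, ρ(x, y) ≤ ρ(ζ_G, x) + ρ(ζ_G, y).
    have h1 : Real.logb q (Berk.diamWedge x y) ≤ 0 :=
      Real.logb_nonpos hq ((Berk.diamG_nonneg x).trans (Berk.le_diamWedge_left x y))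
        (Berk.diamWedge_le_one x y)
    have h2 := (key x hx).2
    have h3 := (key y hy).2
    have h4 : 4 / ((Berk.deg φ : ℝ) - 1) * Berk.ordRes q φ =
        2 / ((Berk.deg φ : ℝ) - 1) * Berk.ordRes q φ +
          2 / ((Berk.deg φ : ℝ) - 1) * Berk.ordRes q φ := by ring
    linarith
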